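/- Let $\mathcal X$ be a smooth ($C^\infty$) manifold of dimension $n$ (Hausdorff, second countable, without boundary). Consider the system $\Sigma$: $\dot x=f(x)+\sum_{i=1}^m g_i(x)u_i$, $y=h(x)$, where $f,g_1,\dots,g_m$ are $C^2$ vector fields on $\mathcal X$, $h:\mathcal X\to\mathcal Y\subseteq\mathbb R^m$ is $C^2$, and the inputs are the $C^2$ functions $u:\mathbb R\to\mathcal U\subseteq\mathbb R^m$. Assume that $\Sigma$ is forward complete: for every input and every initial condition $x(0)\in\mathcal X$ there is a solution defined for all $t\ge 0$. The prolonged system consists of $\Sigma$ and of the variational system, in coordinates, $\dot{\delta x}=\frac{\partial f(x)}{\partial x}\delta x+\frac{\partial (g(x)u)}{\partial x}\delta x+g(x)\delta u$, $\delta y=\frac{\partial h(x)}{\partial x}\delta x$, where $\delta u:\mathbb R\to\mathbb R^m$ is $C^1$. Let $T_x\mathcal X=\mathcal V_x\oplus\mathcal H_x$ be a splitting into a vertical distribution $\mathcal V$ and a horizontal distribution $\mathcal H$, which around each point are spanned by $r$, respectively $q$, $C^1$ vector fields, with $0\le r<n$ and $0<q\le n-r$. A function $\delta S:T\mathcal X\to\mathbb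 R_{\ge 0}$ is a differential storage function, with associated function $F:T\mathcal X\to\mathbb R_{\ge0}$, if there are $c_1>0$, $c_2\ge 0$, $p\ge 1$ and a set $\Omega\subset\mathcal X$ all of whose points are isolated in $\Omega$, such that $c_1F(x,\delta x)^p\le\delta S(x,\delta x)\le c_2F(x,\delta x)^p$ on $T\mathcal X$ and: (i) $\delta S$ and $F$ are $C^1$ at all $(x,\delta x)$ with $\delta x\in\mathcal H_x\setminus\{0\}$, and $\delta S(x,\delta x_h+\delta x_v)=\delta S(x,\delta x_h)$, $F(x,\delta x_h+\delta x_v)=F(x,\delta x_h)$ for $\delta x_h\in\mathcal H_x$, $\delta x_v\in\mathcal V_x$; (ii) $F(x,\delta x)>0$ for $x\in\mathcal X\setminus\Omega$, $\delta x\in\mathcal H_x\setminus\{0\}$; (iii) $F(x,\lambda\,\delta x)=\lambda F(x,\delta x)$ for $\lambda>0$, $x\in\mathcal X$, $\delta x\in\mathcal H_x$; (iv) $F(x,\delta x_1+\delta x_2)<F(x,\delta x_1)+F(x,\delta x_2)$ for $x\in\mathcal X\setminus\Omega$ and $\delta x_1,\delta x_2\in\mathcal H_x\setminus\{0\}$ with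 $\delta x_1\ne\lambda\,\delta x_2$ for all $\lambda\in\mathbb R$. $\Sigma$ is differentially passive with differential storage $\delta S$ if $$\delta S(x(t),\delta x(t))-\delta S(x(0),\delta x(0))\le\int_0^t\delta y(\tau)^T\delta u(\tau)\,d\tau$$ for all $t\ge0$ and all solutions of the prolonged system (on $[0,\infty)$). A distance is a function $d:\mathcal X\times\mathcal X\to\mathbb R_{\ge0}$, not necessarily symmetric, with $d(x,y)=0$ if and only if $x=y$ and $d(x,z)\le d(x,y)+d(y,z)$. $\Sigma$ is incrementally stable with respect to $d$ if $d$ is a continuous distance which generates the topology of $\mathcal X$, and there is a class $\mathcal K$ function $\alpha$ (continuous and strictly increasing on $[0,\infty)$, $\alpha(0)=0$) such that $d(x_1(t),x_2(t))\le\alpha(d(x_1(0),x_2(0)))$ for all $t\ge0$ and any two solutions $x_1,x_2$ on $[0,\infty)$ of $\Sigma$ under the same input; $d$ and $\alpha$ do not depend on the input. $\Sigma$ is incrementally stable if it is so with respect to some $d$. **Theorem.** Let $\Sigma$ be differentially passive with a differential storage $\delta S$, with associated function $F$, whose vertical distribution is trivial: $\mathcal V_x=0$ for each $x\in\mathcal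 X$. Then $\Sigma$ is incrementally stable. If moreover $\mathcal X$ is connected, $\Sigma$ is incrementally stable with respect to the distance induced by $F$, $d(x,y)=\inf_\gamma\int_0^1F(\gamma(s),\dot\gamma(s))\,ds$, the infimum being over the $C^1$ curves $\gamma:[0,1]\to\mathcal X$ with $\gamma(0)=x$, $\gamma(1)=y$. -/

import Mathlib

open Set
open scoped Manifold ContDiff Topology ENNReal

-- make instance search find the standard manifold structure of a vector space first
attribute [local instance 2000] chartedSpaceSelf

noncomputable section

namespace DiffPassivity

section Geometry

variable {n : ℕ} {X : Type*} [TopologicalSpace X] [ChartedSpace (EuclideanSpace ℝ (Fin n)) X]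

/-- A vector field on `X` (a section of the tangent bundle). -/
abbrev VField (n : ℕ) (X : Type*) [TopologicalSpace X]
    [ChartedSpace (EuclideanSpace ℝ (Fin n)) X] : Type _ :=
  (x : X) → TangentSpace (𝓡 n) x

/-- Coordinates, in the chart `φ` of the atlas at `x₀`, of a tangent vector `v` at `x`,
that is `dφ_x v`. -/
def vecCoord (x₀ : X) {x : X} (v : TangentSpace (𝓡 n) x) : EuclideanSpace ℝ (Fin n) :=
  mfderiv (𝓡 n) 𝓘(ℝ, EuclideanSpace ℝ (Fin n)) (extChartAt (𝓡 n) x₀) x v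

/-- Coordinate expression, in the chart of the atlas at `x₀`, of a vector field. -/
def fieldCoord (x₀ : X) (w : VField n X) (z : EuclideanSpace ℝ (Fin n)) :
    EuclideanSpace ℝ (Fin n) :=
  vecCoord x₀ (w ((extChartAt (𝓡 n) x₀).symm z))

variable [IsManifold (𝓡 n) ∞ X]

/-- The vector field `w` is of class `C^k` on the set `s`. -/
def IsCkFieldOn (k : ℕ) (w : VField n X) (s : Set X) : Prop :=
  ContMDiffOn (𝓡 n) (𝓡 n).tangent k (fun x ↦ (⟨x, w x⟩ : TangentBundle (𝓡 n) X)) s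

/-- A splitting `T_x X = V_x ⊕ H_x` into a vertical distribution `V` spanned by `r` vector fields,
`0 ≤ r < n`, and a horizontal distribution `H` spanned by `q` vector fields, `0 < q ≤ n - r`,
all of class `C^1`. The spanning fields are only asked to exist around each point, so that
manifolds whose tangent bundle is not trivial are allowed. -/
structure IsSplitting (V H : (x : X) → Submodule ℝ (TangentSpace (𝓡 n) x)) : Prop where
  compl : ∀ x, IsCompl (V x) (H x)
  spanned : ∃ r q : ℕ, r < n ∧ 0 < q ∧ q + r ≤ n ∧
    ∀ x₀ : X, ∃ s : Set X, IsOpen s ∧ x₀ ∈ s ∧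
      ∃ (v : Fin r → VField n X) (h : Fin q → VField n X),
        (∀ i, IsCkFieldOn 1 (v i) s) ∧ (∀ i, IsCkFieldOn 1 (h i) s) ∧
        ∀ x ∈ s, V x = Submodule.span ℝ (Set.range fun i ↦ v i x) ∧
          H x = Submodule.span ℝ (Set.range fun i ↦ h i x)

/-- `δS : TX → ℝ≥0` is a differential storage function with vertical distribution `V`,
horizontal distribution `H` and associated function `F : TX → ℝ≥0`. -/
structure IsDifferentialStorage (V H : (x : X) → Submodule ℝ (TangentSpace (𝓡 n) x))
    (F δS : TangentBundle (𝓡 n) X → ℝ) : Prop where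
  splitting : IsSplitting V H
  nonneg_F : ∀ ξ, 0 ≤ F ξ
  nonneg_δS : ∀ ξ, 0 ≤ δS ξ
  /-- two-sided bound by a power of `F` -/
  bounds : ∃ c₁ c₂ p : ℝ, 0 < c₁ ∧ 0 ≤ c₂ ∧ 1 ≤ p ∧
    ∀ ξ, c₁ * F ξ ^ p ≤ δS ξ ∧ δS ξ ≤ c₂ * F ξ ^ p
  contMDiff_δS : ∀ (x : X), ∀ v ∈ H x, v ≠ 0 → ContMDiffAt (𝓡 n).tangent 𝓘(ℝ, ℝ) 1 δS ⟨x, v⟩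
  contMDiff_F : ∀ (x : X), ∀ v ∈ H x, v ≠ 0 → ContMDiffAt (𝓡 n).tangent 𝓘(ℝ, ℝ) 1 F ⟨x, v⟩
  /-- only the horizontal component matters -/
  horizontal : ∀ (x : X), ∀ a ∈ H x, ∀ b ∈ V x,
    δS ⟨x, a + b⟩ = δS ⟨x, a⟩ ∧ F ⟨x, a + b⟩ = F ⟨x, a⟩
  homogeneous : ∀ (x : X), ∀ v ∈ H x, ∀ c : ℝ, 0 < c → F ⟨x, c • v⟩ = c * F ⟨x, v⟩
  /-- positivity and strict convexity hold away from a set `Ω` of isolated points -/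
  isolated : ∃ Ω : Set X, DiscreteTopology Ω ∧
    (∀ x ∉ Ω, ∀ v ∈ H x, v ≠ 0 → 0 < F ⟨x, v⟩) ∧
    ∀ x ∉ Ω, ∀ v ∈ H x, ∀ w ∈ H x, v ≠ 0 → w ≠ 0 → (∀ c : ℝ, v ≠ c • w) →
      F ⟨x, v + w⟩ < F ⟨x, v⟩ + F ⟨x, w⟩

/-- The `F`-length `∫₀¹ F(γ(s), γ'(s)) ds` of a curve defined on `[0, 1]`. -/
def finslerLength (F : TangentBundle (𝓡 n) X → ℝ) (γ : ℝ → X) : ℝ≥0∞ :=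
  ∫⁻ s in Icc (0 : ℝ) 1,
    ENNReal.ofReal (F ⟨γ s, mfderivWithin 𝓘(ℝ, ℝ) (𝓡 n) γ (Icc 0 1) s (1 : ℝ)⟩)

/-- The distance induced by `F`: the infimum of the `F`-lengths of the `C^1` curves from
`x` to `y`. -/
def finslerDist (F : TangentBundle (𝓡 n) X → ℝ) (x y : X) : ℝ :=
  (⨅ (γ : ℝ → X) (_ : ContMDiffOn 𝓘(ℝ, ℝ) (𝓡 n) 1 γ (Icc 0 1)) (_ : γ 0 = x) (_ : γ 1 = y),
    finslerLength F γ).toReal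

end Geometry

/-- A (not necessarily symmetric) distance. -/
structure IsDistance {X : Type*} (d : X → X → ℝ) : Prop where
  nonneg : ∀ x y, 0 ≤ d x y
  eq_zero_iff : ∀ x y, d x y = 0 ↔ x = y
  triangle : ∀ x y z, d x z ≤ d x y + d y z

/-- The distance `d` is continuous and its balls generate the topology of `X`. -/
def GeneratesTopology {X : Type*} [TopologicalSpace X] (d : X → X → ℝ) : Prop :=
  Continuous (fun p : X × X ↦ d p.1 p.2) ∧
    ∀ x, ∀ s ∈ 𝓝 x, ∃ ε > 0, ∀ y, d x y < ε ∨ d y x < ε → y ∈ s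

/-- Class `K` functions `[0, ∞) → [0, ∞)`. -/
structure IsClassK (α : ℝ → ℝ) : Prop where
  continuousOn : ContinuousOn α (Ici 0)
  strictMonoOn : StrictMonoOn α (Ici 0)
  zero : α 0 = 0

/-- The system `ẋ = f(x) + g(x) u`, `y = h(x)` with state space `X`, inputs in `U ⊆ ℝᵐ` and outputs
in `Y ⊆ ℝᵐ`, with data of class `C^2`; `g i` is the `i`-th column of `g`. -/
structure ControlSystem (n m : ℕ) (X : Type*) [TopologicalSpace X]
    [ChartedSpace (EuclideanSpace ℝ (Fin n)) X] [IsManifold (𝓡 n) ∞ X] where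
  U : Set (EuclideanSpace ℝ (Fin m))
  Y : Set (EuclideanSpace ℝ (Fin m))
  f : VField n X
  g : Fin m → VField n X
  h : X → EuclideanSpace ℝ (Fin m)
  h_mem : ∀ x, h x ∈ Y
  f_C2 : IsCkFieldOn 2 f univ
  g_C2 : ∀ i, IsCkFieldOn 2 (g i) univ
  h_C2 : ContMDiff (𝓡 n) 𝓘(ℝ, EuclideanSpace ℝ (Fin m)) 2 h

namespace ControlSystem

variable {n m : ℕ} {X : Type*} [TopologicalSpace X] [ChartedSpace (EuclideanSpace ℝ (Fin n)) X]
  [IsManifold (𝓡 n) ∞ X]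

/-- Admissible input signals: `C^2` functions `u : ℝ → U`. -/
def IsInput (S : ControlSystem n m X) (u : ℝ → EuclideanSpace ℝ (Fin m)) : Prop :=
  ContDiff ℝ 2 u ∧ ∀ t, u t ∈ S.U

/-- `x` is a solution on `[0, ∞)` under the input `u` (its values at negative times are
irrelevant). -/
def IsSolution (S : ControlSystem n m X) (u : ℝ → EuclideanSpace ℝ (Fin m)) (x : ℝ → X) : Prop :=
  ∀ t, 0 ≤ t → HasMFDerivWithinAt 𝓘(ℝ, ℝ) (𝓡 n) x (Ici 0) t
    ((1 : ℝ →L[ℝ] ℝ).smulRight (S.f (x t) + ∑ i, u t i • S.g i (x t)))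

/-- `δx` is a solution on `[0, ∞)` of the variational system
`δẋ = ∂f/∂x δx + ∂(g u)/∂x δx + g δu` along `x` with input `u` and input variation `δu`:
the equation holds in the coordinates of every chart of the atlas, as long as `x` is in its
domain. -/
def IsVariationalSolution (S : ControlSystem n m X) (u : ℝ → EuclideanSpace ℝ (Fin m)) (x : ℝ → X)
    (δu : ℝ → EuclideanSpace ℝ (Fin m)) (δx : (t : ℝ) → TangentSpace (𝓡 n) (x t)) : Prop :=
  ∀ (x₀ : X) (t : ℝ), 0 ≤ t → x t ∈ (extChartAt (𝓡 n) x₀).source →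
    HasDerivWithinAt (fun τ ↦ vecCoord x₀ (δx τ))
      (fderiv ℝ (fieldCoord x₀ S.f) (extChartAt (𝓡 n) x₀ (x t)) (vecCoord x₀ (δx t))
        + ∑ i, u t i •
            fderiv ℝ (fieldCoord x₀ (S.g i)) (extChartAt (𝓡 n) x₀ (x t)) (vecCoord x₀ (δx t))
        + ∑ i, δu t i • fieldCoord x₀ (S.g i) (extChartAt (𝓡 n) x₀ (x t)))
      (Ici 0) t

/-- The output variation `δy = ∂h/∂x δx`. -/
def outputVariation (S : ControlSystem n m X) {x : X} (v : TangentSpace (𝓡 n) x) :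
    EuclideanSpace ℝ (Fin m) :=
  mfderiv (𝓡 n) 𝓘(ℝ, EuclideanSpace ℝ (Fin m)) S.h x v

/-- The differential passivity inequality for `δS`, along all solutions of the prolonged system. -/
def PassivityInequality (S : ControlSystem n m X) (δS : TangentBundle (𝓡 n) X → ℝ) : Prop :=
  ∀ (u : ℝ → EuclideanSpace ℝ (Fin m)) (x : ℝ → X) (δu : ℝ → EuclideanSpace ℝ (Fin m))
    (δx : (t : ℝ) → TangentSpace (𝓡 n) (x t)),
    S.IsInput u → S.IsSolution u x → ContDiff ℝ 1 δu → S.IsVariationalSolution u x δu δx →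
    ∀ t, 0 ≤ t → δS ⟨x t, δx t⟩ - δS ⟨x 0, δx 0⟩ ≤
      ∫ τ in (0 : ℝ)..t, inner ℝ (S.outputVariation (δx τ)) (δu τ)

/-- The system is differentially passive with differential storage `δS` (with associated
function `F`) for the vertical and horizontal distributions `V` and `H`. -/
def DifferentiallyPassiveWith (S : ControlSystem n m X)
    (V H : (x : X) → Submodule ℝ (TangentSpace (𝓡 n) x))
    (F δS : TangentBundle (𝓡 n) X → ℝ) : Prop :=
  IsDifferentialStorage V H F δS ∧ S.PassivityInequality δS

/-- For every input and every initial condition there is a solution for all times `t ≥ 0`. -/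
def ForwardComplete (S : ControlSystem n m X) : Prop :=
  ∀ u, S.IsInput u → ∀ x₀ : X, ∃ x : ℝ → X, S.IsSolution u x ∧ x 0 = x₀

/-- Incremental stability with respect to the distance `d`: there is a class `K` function `α`
such that `d(x₁(t), x₂(t)) ≤ α(d(x₁(0), x₂(0)))`, for all `t ≥ 0`, along any two solutions with
the same input. -/
def IncrementallyStableWrt (S : ControlSystem n m X) (d : X → X → ℝ) : Prop :=
  IsDistance d ∧ GeneratesTopology d ∧ ∃ α : ℝ → ℝ, IsClassK α ∧
    ∀ u, S.IsInput u → ∀ x₁ x₂ : ℝ → X, S.IsSolution u x₁ → S.IsSolution u x₂ →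
      ∀ t, 0 ≤ t → d (x₁ t) (x₂ t) ≤ α (d (x₁ 0) (x₂ 0))

/-- Incremental stability: with respect to some distance on the manifold. -/
def IncrementallyStable (S : ControlSystem n m X) : Prop :=
  ∃ d : X → X → ℝ, S.IncrementallyStableWrt d

end ControlSystem

end DiffPassivity

end

/-! Since the vertical spaces vanish, every tangent vector is horizontal and `δS` is comparable to
`F ^ p` on the whole tangent bundle. With `δu = 0` the supply rate vanishes, so `δS` does not
increase along variational solutions, and `F(δx(t)) ≤ k F(δx(0))` with a constant `k` depending only
on `c₁, c₂, p` (`exists_velocityWithin_le`).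

To pass from tangent vectors to points, join `x₁(0)` to `x₂(0)` by a `C^1` curve `γ` and let `c s`
be a solution starting at `γ s`, under the common input. The derivative of `c s t` in `s` solves the
variational equation with `δu = 0` (`isVariationalSolution_of_solutions`), so its `F`-value is at
most `k F(γ'(s))`. Integrating in `s` and taking the infimum over `γ` gives `d(x₁(t), x₂(t)) ≤ k
d(x₁(0), x₂(0))`, so `α(r) = k r` works.

Only pointwise differentiability of `s ↦ c s t` is proved. Instead of measuring the length of that
curve, the proof bounds the upper right Dini derivative of `s ↦ d(c 0 t, c s t)` by the continuous
function `k F(γ'(s))` and applies a mean value inequality (`IsFinsler.min_finslerEDist_le`).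

It remains that `d` is a distance generating the topology. Chart segments bound it from above near
each point. From below, `F` may degenerate on the set `Ω` of isolated points, but every point is the
centre of small annuli on which `F` dominates a multiple of the Euclidean norm, and a curve leaving
the point must cross one (`IsFinsler.exists_le_finslerEDist`). On a connected manifold `d` is
finite; in general `min(d, 1)` is used. -/

namespace DiffPassivity

/-! ### Tangent vectors, vector fields and velocities in charts -/

section Coordinates

variable {n : ℕ} {X : Type*} [TopologicalSpace X] [ChartedSpace (EuclideanSpace ℝ (Fin n)) X]

lemma vecCoord_zero (x₀ x : X) : vecCoord x₀ (0 : TangentSpace (𝓡 n) x) = 0 := map_zero _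

lemma vecCoord_add (x₀ : X) {x : X} (v w : TangentSpace (𝓡 n) x) :
    vecCoord x₀ (v + w) = vecCoord x₀ v + vecCoord x₀ w := map_add _ _ _

lemma vecCoord_smul (x₀ : X) {x : X} (c : ℝ) (v : TangentSpace (𝓡 n) x) :
    vecCoord x₀ (c • v) = c • vecCoord x₀ v := map_smul _ _ _

lemma vecCoord_sum (x₀ : X) {x : X} {ι : Type*} (s : Finset ι)
    (v : ι → TangentSpace (𝓡 n) x) :
    vecCoord x₀ (∑ i ∈ s, v i) = ∑ i ∈ s, vecCoord x₀ (v i) := map_sum _ _ _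

lemma fieldCoord_extChartAt {x₀ x : X} (hx : x ∈ (extChartAt (𝓡 n) x₀).source)
    (w : VField n X) : fieldCoord x₀ w (extChartAt (𝓡 n) x₀ x) = vecCoord x₀ (w x) := by
  -- The type of `w y` depends on `y`, so the equality of base points is substituted rather than
  -- rewritten.
  have : ∀ y, y = x → vecCoord x₀ (w y) = vecCoord x₀ (w x) := by rintro y rfl; rfl
  exact this _ ((extChartAt (𝓡 n) x₀).left_inv hx)

variable [IsManifold (𝓡 n) ∞ X]

/-- The inverse of the chart of the tangent bundle induced by the chart of `X` at `x₀`. -/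
noncomputable def tangentChart (x₀ : X)
    (p : EuclideanSpace ℝ (Fin n) × EuclideanSpace ℝ (Fin n)) : TangentBundle (𝓡 n) X :=
  (trivializationAt (EuclideanSpace ℝ (Fin n)) (TangentSpace (𝓡 n)) x₀).toOpenPartialHomeomorph.symm
    ((extChartAt (𝓡 n) x₀).symm p.1, p.2)

lemma continuousOn_tangentChart (x₀ : X) :
    ContinuousOn (tangentChart x₀) ((extChartAt (𝓡 n) x₀).target ×ˢ univ) := by
  refine (OpenPartialHomeomorph.continuousOn_symm _).comp
    (((continuousOn_extChartAt_symm x₀).comp continuousOn_fst fun p hp ↦ hp.1).prodMk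
      continuousOn_snd) ?_
  rintro ⟨z, v⟩ ⟨hz, -⟩
  have := (extChartAt (𝓡 n) x₀).map_target hz
  rw [extChartAt_source] at this
  simpa [Bundle.Trivialization.target_eq] using this

/-- Reconciles the two descriptions of coordinates: the differential of the chart, in which the
equations are written, and the trivialization, which carries the topology of the tangent bundle. -/
lemma vecCoord_eq_continuousLinearMapAt {x₀ x : X} (hx : x ∈ (extChartAt (𝓡 n) x₀).source)
    (v : TangentSpace (𝓡 n) x) : vecCoord x₀ v =
      (trivializationAt (EuclideanSpace ℝ (Fin n)) (TangentSpace (𝓡 n)) x₀).continuousLinearMapAt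
        ℝ x v := by
  rw [extChartAt_source] at hx
  rw [TangentBundle.continuousLinearMapAt_trivializationAt hx]
  rfl

lemma vecCoord_eq_trivializationAt {x₀ x : X} (hx : x ∈ (extChartAt (𝓡 n) x₀).source)
    (v : TangentSpace (𝓡 n) x) : vecCoord x₀ v =
      (trivializationAt (EuclideanSpace ℝ (Fin n)) (TangentSpace (𝓡 n)) x₀ ⟨x, v⟩).2 := by
  rw [vecCoord_eq_continuousLinearMapAt hx]
  rw [extChartAt_source] at hx
  rw [Bundle.Trivialization.continuousLinearMapAt_apply,
    Bundle.Trivialization.linearMapAt_apply, if_pos (by simpa using hx)]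

lemma tangentChart_vecCoord {x₀ x : X} (hx : x ∈ (extChartAt (𝓡 n) x₀).source)
    (v : TangentSpace (𝓡 n) x) :
    tangentChart x₀ (extChartAt (𝓡 n) x₀ x, vecCoord x₀ v) = ⟨x, v⟩ := by
  set e := trivializationAt (EuclideanSpace ℝ (Fin n)) (TangentSpace (𝓡 n) (M := X)) x₀ with he
  have hb : (⟨x, v⟩ : TangentBundle (𝓡 n) X) ∈ e.source := by
    rw [extChartAt_source] at hx
    simpa [e, Bundle.Trivialization.mem_source] using hx
  have : ((x, vecCoord x₀ v) : X × EuclideanSpace ℝ (Fin n)) = e ⟨x, v⟩ := by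
    ext1
    · rw [Bundle.Trivialization.coe_fst _ hb]
    · exact vecCoord_eq_trivializationAt hx v
  rw [tangentChart, (extChartAt (𝓡 n) x₀).left_inv hx]
  simp only
  rw [this]
  exact e.toOpenPartialHomeomorph.left_inv hb

lemma exists_vecCoord_eq {x₀ x : X} (hx : x ∈ (extChartAt (𝓡 n) x₀).source)
    (v : EuclideanSpace ℝ (Fin n)) : ∃ w : TangentSpace (𝓡 n) x, vecCoord x₀ w = v := by
  set e := trivializationAt (EuclideanSpace ℝ (Fin n)) (TangentSpace (𝓡 n) (M := X)) x₀ with he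
  refine ⟨e.symmL ℝ x v, ?_⟩
  rw [vecCoord_eq_continuousLinearMapAt hx]
  rw [extChartAt_source] at hx
  exact e.continuousLinearMapAt_symmL (by simpa [e] using hx) v

lemma contDiffOn_fieldCoord (x₀ : X) {k : ℕ} {w : VField n X} (hw : IsCkFieldOn k w univ) :
    ContDiffOn ℝ k (fieldCoord x₀ w) (extChartAt (𝓡 n) x₀).target := by
  rw [← contMDiffOn_iff_contDiffOn]
  set e := trivializationAt (EuclideanSpace ℝ (Fin n)) (TangentSpace (𝓡 n) (M := X)) x₀ with he
  have h1 : ContMDiffOn (𝓡 n) 𝓘(ℝ, EuclideanSpace ℝ (Fin n)) k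
      (fun x ↦ (e ⟨x, w x⟩).2) e.baseSet := by
    have : IsManifold (𝓡 n) ((k : WithTop ℕ∞) + 1) X := .of_le (n := ∞) (by
      exact_mod_cast le_top)
    have := ContMDiffVectorBundle (k : WithTop ℕ∞) (EuclideanSpace ℝ (Fin n))
      (TangentSpace (𝓡 n) (M := X)) (𝓡 n)
    exact (e.contMDiffOn_section_baseSet_iff (s := w)).1 (hw.mono (subset_univ _))
  have h2 : ContMDiffOn 𝓘(ℝ, EuclideanSpace ℝ (Fin n)) (𝓡 n) k (extChartAt (𝓡 n) x₀).symm
      (extChartAt (𝓡 n) x₀).target :=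
    (contMDiffOn_extChartAt_symm (n := ∞) x₀).of_le (by exact_mod_cast le_top)
  refine (h1.comp h2 ?_).congr ?_
  · intro z hz
    have := (extChartAt (𝓡 n) x₀).map_target hz
    rw [extChartAt_source] at this
    simpa [e] using this
  · intro z hz
    exact vecCoord_eq_trivializationAt ((extChartAt (𝓡 n) x₀).map_target hz) _

lemma HasMFDerivWithinAt.hasDerivWithinAt_extChartAt {x₀ : X} {γ : ℝ → X} {s : Set ℝ} {t : ℝ}
    {γ' : ℝ →L[ℝ] TangentSpace (𝓡 n) (γ t)}
    (h : HasMFDerivWithinAt 𝓘(ℝ, ℝ) (𝓡 n) γ s t γ')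
    (ht : γ t ∈ (extChartAt (𝓡 n) x₀).source) :
    HasDerivWithinAt (fun τ ↦ extChartAt (𝓡 n) x₀ (γ τ)) (vecCoord x₀ (γ' 1)) s t := by
  rw [extChartAt_source] at ht
  have h1 := (mdifferentiableAt_extChartAt (I := 𝓡 n) ht).hasMFDerivAt
  have h2 := h1.comp_hasMFDerivWithinAt t h
  let L : ℝ →L[ℝ] EuclideanSpace ℝ (Fin n) :=
    (mfderiv (𝓡 n) 𝓘(ℝ, EuclideanSpace ℝ (Fin n)) (extChartAt (𝓡 n) x₀) (γ t)).comp γ'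
  have h3 : HasFDerivWithinAt (fun τ ↦ extChartAt (𝓡 n) x₀ (γ τ)) L s t :=
    hasMFDerivWithinAt_iff_hasFDerivWithinAt.1 h2
  exact HasFDerivWithinAt.hasDerivWithinAt h3

/-- A curve is differentiable as soon as its expression in a chart is. -/
lemma mdifferentiableWithinAt_of_extChartAt {x₀ : X} {γ : ℝ → X} {s : Set ℝ} {t : ℝ}
    (hc : ContinuousWithinAt γ s t) (ht : γ t ∈ (extChartAt (𝓡 n) x₀).source)
    (h : DifferentiableWithinAt ℝ (fun τ ↦ extChartAt (𝓡 n) x₀ (γ τ)) s t) :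
    MDifferentiableWithinAt 𝓘(ℝ, ℝ) (𝓡 n) γ s t := by
  rw [extChartAt_source] at ht
  exact (mdifferentiableWithinAt_iff_target_of_mem_source ht).2
    ⟨hc, h.mdifferentiableWithinAt⟩

end Coordinates

end DiffPassivity

namespace DiffPassivity

/-! ### Continuity of `F` and its comparison with the Euclidean norm in charts -/

section Finsler

open MeasureTheory

variable {n : ℕ} {X : Type*} [TopologicalSpace X] [ChartedSpace (EuclideanSpace ℝ (Fin n)) X]

/-- The velocity of a curve, within a set of times, as an element of the tangent bundle. -/
noncomputable def velocityWithin (γ : ℝ → X) (s : Set ℝ) (t : ℝ) : TangentBundle (𝓡 n) X :=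
  ⟨γ t, mfderivWithin 𝓘(ℝ, ℝ) (𝓡 n) γ s t (1 : ℝ)⟩

variable [IsManifold (𝓡 n) ∞ X]

/-- One vector `w` serves all scalars `c`, so that homogeneity of `F` in the fibres carries over to
chart coordinates. -/
lemma exists_tangentChart_eq_mk {x₀ : X} {z : EuclideanSpace ℝ (Fin n)}
    (hz : z ∈ (extChartAt (𝓡 n) x₀).target) (v : EuclideanSpace ℝ (Fin n)) :
    ∃ w : TangentSpace (𝓡 n) ((extChartAt (𝓡 n) x₀).symm z), vecCoord x₀ w = v ∧
      ∀ c : ℝ, tangentChart x₀ (z, c • v) = ⟨(extChartAt (𝓡 n) x₀).symm z, c • w⟩ := by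
  have hs := (extChartAt (𝓡 n) x₀).map_target hz
  obtain ⟨w, hw⟩ := exists_vecCoord_eq hs v
  refine ⟨w, hw, fun c ↦ ?_⟩
  rw [← tangentChart_vecCoord hs, vecCoord_smul, hw, (extChartAt (𝓡 n) x₀).right_inv hz]

/-- The velocity of a curve, read in a chart of the tangent bundle. -/
lemma tangentChart_velocityWithin {x₀ : X} {γ : ℝ → X} {s : Set ℝ} {t : ℝ}
    {v : EuclideanSpace ℝ (Fin n)} (hs : UniqueDiffWithinAt ℝ s t)
    (hγ : MDifferentiableWithinAt 𝓘(ℝ, ℝ) (𝓡 n) γ s t)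
    (ht : γ t ∈ (extChartAt (𝓡 n) x₀).source)
    (hv : HasDerivWithinAt (fun τ ↦ extChartAt (𝓡 n) x₀ (γ τ)) v s t) :
    tangentChart x₀ (extChartAt (𝓡 n) x₀ (γ t), v) = velocityWithin γ s t := by
  have h := HasMFDerivWithinAt.hasDerivWithinAt_extChartAt hγ.hasMFDerivWithinAt ht
  have h' : v = vecCoord x₀ (mfderivWithin 𝓘(ℝ, ℝ) (𝓡 n) γ s t (1 : ℝ)) := hs.eq_deriv _ hv h
  rw [h', tangentChart_vecCoord ht]
  rfl

/-- A continuous, positively homogeneous, nonnegative function on the tangent bundle, which is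
positive definite away from a set of isolated points. -/
structure IsFinsler (F : TangentBundle (𝓡 n) X → ℝ) : Prop where
  continuous : Continuous F
  nonneg : ∀ ξ, 0 ≤ F ξ
  homogeneous : ∀ (x : X) (v : TangentSpace (𝓡 n) x) (c : ℝ), 0 < c →
    F ⟨x, c • v⟩ = c * F ⟨x, v⟩
  isolated : ∃ Ω : Set X, DiscreteTopology Ω ∧
    ∀ x ∉ Ω, ∀ v : TangentSpace (𝓡 n) x, v ≠ 0 → 0 < F ⟨x, v⟩

lemma homogeneous_tangentChart {F : TangentBundle (𝓡 n) X → ℝ}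
    (hF : ∀ (x : X) (v : TangentSpace (𝓡 n) x) (c : ℝ), 0 < c → F ⟨x, c • v⟩ = c * F ⟨x, v⟩)
    {x₀ : X} {z : EuclideanSpace ℝ (Fin n)} (hz : z ∈ (extChartAt (𝓡 n) x₀).target)
    (v : EuclideanSpace ℝ (Fin n)) {c : ℝ} (hc : 0 ≤ c) :
    F (tangentChart x₀ (z, c • v)) = c * F (tangentChart x₀ (z, v)) := by
  obtain ⟨w, -, hw⟩ := exists_tangentChart_eq_mk hz v
  have h1 := hw 1
  rw [one_smul, one_smul] at h1
  rw [h1, hw]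
  rcases hc.eq_or_lt with rfl | hc
  -- Homogeneity with factor `2` at the zero vector forces `F` to vanish there.
  · have := hF _ (0 : TangentSpace (𝓡 n) ((extChartAt (𝓡 n) x₀).symm z)) 2 two_pos
    rw [smul_zero] at this
    rw [zero_smul]
    linarith
  · exact hF _ w c hc

/-- Maximum over `K` times the unit sphere, extended by homogeneity. Continuity is required only off
the zero section, so that the bound can be used to prove continuity on the zero section. -/
lemma exists_tangentChart_le {F : TangentBundle (𝓡 n) X → ℝ}
    (hF : ∀ (x : X) (v : TangentSpace (𝓡 n) x) (c : ℝ), 0 < c → F ⟨x, c • v⟩ = c * F ⟨x, v⟩)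
    (hcont : ∀ (x : X) (v : TangentSpace (𝓡 n) x), v ≠ 0 → ContinuousAt F ⟨x, v⟩)
    {x₀ : X} {K : Set (EuclideanSpace ℝ (Fin n))} (hK : IsCompact K)
    (hKt : K ⊆ (extChartAt (𝓡 n) x₀).target) :
    ∃ M : ℝ, 0 ≤ M ∧ ∀ z ∈ K, ∀ v, F (tangentChart x₀ (z, v)) ≤ M * ‖v‖ := by
  have hc : ContinuousOn (fun p ↦ F (tangentChart x₀ p)) (K ×ˢ Metric.sphere 0 1) := by
    rintro ⟨z, v⟩ ⟨hz, hv⟩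
    obtain ⟨w, hw, hw'⟩ := exists_tangentChart_eq_mk (hKt hz) v
    have h1 := hw' 1
    rw [one_smul, one_smul] at h1
    have hw0 : w ≠ 0 := by
      rintro rfl
      rw [vecCoord_zero] at hw
      simp [← hw] at hv
    have h2 : ContinuousAt F (tangentChart x₀ (z, v)) := by rw [h1]; exact hcont _ _ hw0
    exact h2.comp_continuousWithinAt ((continuousOn_tangentChart x₀ (z, v) ⟨hKt hz, trivial⟩).mono
      (prod_mono hKt (subset_univ _)))
  obtain ⟨M, hM⟩ := (hK.prod (isCompact_sphere 0 1)).bddAbove_image hc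
  refine ⟨max M 0, le_max_right _ _, fun z hz v ↦ ?_⟩
  rcases eq_or_ne v 0 with rfl | hv
  · have := homogeneous_tangentChart hF (hKt hz) 0 le_rfl
    rw [smul_zero, zero_mul] at this
    simp [this]
  · have h1 : F (tangentChart x₀ (z, ‖v‖⁻¹ • v)) ≤ M :=
      hM (mem_image_of_mem _ ⟨hz, by simp [norm_smul, hv]⟩)
    have h2 := homogeneous_tangentChart hF (hKt hz) (‖v‖⁻¹ • v) (norm_nonneg v)
    rw [smul_inv_smul₀ (norm_ne_zero_iff.2 hv)] at h2
    rw [h2, mul_comm]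
    gcongr
    exact h1.trans (le_max_left _ _)

/-- Near a zero vector, `F` is squeezed between `0` and a multiple of the norm of the fibre
coordinate. -/
lemma continuous_of_continuousAt_ne_zero {F : TangentBundle (𝓡 n) X → ℝ}
    (h0 : ∀ ξ, 0 ≤ F ξ)
    (hF : ∀ (x : X) (v : TangentSpace (𝓡 n) x) (c : ℝ), 0 < c → F ⟨x, c • v⟩ = c * F ⟨x, v⟩)
    (hcont : ∀ (x : X) (v : TangentSpace (𝓡 n) x), v ≠ 0 → ContinuousAt F ⟨x, v⟩) :
    Continuous F := by
  rw [continuous_iff_continuousAt]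
  rintro ⟨x, v⟩
  rcases ne_or_eq v 0 with hv | rfl
  · exact hcont x v hv
  set φ := extChartAt (𝓡 n) x
  set e := trivializationAt (EuclideanSpace ℝ (Fin n)) (TangentSpace (𝓡 n) (M := X)) x with he
  have hx : x ∈ φ.source := mem_extChartAt_source x
  obtain ⟨ρ, hρ, hρt⟩ := Metric.nhds_basis_closedBall.mem_iff.1
    ((isOpen_extChartAt_target x).mem_nhds (φ.map_source hx))
  obtain ⟨M, hM0, hM⟩ := exists_tangentChart_le hF hcont (isCompact_closedBall (φ x) ρ) hρt
  have hz : F ⟨x, 0⟩ = 0 := by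
    have := hF x 0 2 two_pos
    rw [smul_zero] at this
    linarith
  have hproj : Filter.Tendsto (fun ξ : TangentBundle (𝓡 n) X ↦ ξ.proj) (𝓝 ⟨x, 0⟩) (𝓝 x) :=
    (FiberBundle.continuous_proj (EuclideanSpace ℝ (Fin n)) (TangentSpace (𝓡 n))).tendsto
      (⟨x, 0⟩ : TangentBundle (𝓡 n) X)
  have hmem : (⟨x, 0⟩ : TangentBundle (𝓡 n) X) ∈ e.source := by
    simp [e]
  have h1 : Filter.Tendsto (fun ξ : TangentBundle (𝓡 n) X ↦ M * ‖(e ξ).2‖) (𝓝 ⟨x, 0⟩) (𝓝 0) := by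
    have hc : ContinuousAt (fun ξ : TangentBundle (𝓡 n) X ↦ M * ‖(e ξ).2‖) ⟨x, 0⟩ :=
      continuousAt_const.mul
        (continuous_snd.continuousAt.comp (e.toOpenPartialHomeomorph.continuousAt hmem)).norm
    have : M * ‖(e ⟨x, 0⟩).2‖ = 0 := by
      rw [← vecCoord_eq_trivializationAt hx, vecCoord_zero]; simp
    simpa [ContinuousAt, this] using hc
  rw [ContinuousAt, hz]
  refine squeeze_zero' (Filter.Eventually.of_forall h0) ?_ h1
  filter_upwards [hproj (extChartAt_source_mem_nhds (I := 𝓡 n) x),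
    hproj ((continuousAt_extChartAt (I := 𝓡 n) x) (Metric.closedBall_mem_nhds _ hρ))]
  rintro ⟨y, w⟩ hy hy'
  rw [← vecCoord_eq_trivializationAt hy]
  have := hM _ hy' (vecCoord x w)
  rwa [tangentChart_vecCoord hy] at this

/-- A complement of the zero subspace is everything, so the conditions on horizontal vectors become
conditions on all tangent vectors. -/
lemma IsDifferentialStorage.isFinsler {V H : (x : X) → Submodule ℝ (TangentSpace (𝓡 n) x)}
    {F δS : TangentBundle (𝓡 n) X → ℝ} (h : IsDifferentialStorage V H F δS)
    (hV : ∀ x, V x = ⊥) : IsFinsler F := by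
  have hH : ∀ x (v : TangentSpace (𝓡 n) x), v ∈ H x := by
    intro x v
    have := h.splitting.compl x
    rw [hV x] at this
    rw [eq_top_of_bot_isCompl this]
    trivial
  have hhom : ∀ (x : X) (v : TangentSpace (𝓡 n) x) (c : ℝ), 0 < c →
    F ⟨x, c • v⟩ = c * F ⟨x, v⟩ := fun x v c hc ↦ h.homogeneous x v (hH x v) c hc
  refine ⟨continuous_of_continuousAt_ne_zero h.nonneg_F hhom fun x v hv ↦
    (h.contMDiff_F x v (hH x v) hv).continuousAt, h.nonneg_F, hhom, ?_⟩
  obtain ⟨Ω, hΩ, hpos, -⟩ := h.isolated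
  exact ⟨Ω, hΩ, fun x hx v hv ↦ hpos x hx v (hH x v) hv⟩

namespace IsFinsler

variable {F : TangentBundle (𝓡 n) X → ℝ}

lemma zero (hF : IsFinsler F) (x : X) : F ⟨x, 0⟩ = 0 := by
  have := hF.homogeneous x 0 2 two_pos
  rw [smul_zero] at this
  linarith

lemma smul (hF : IsFinsler F) (x : X) (v : TangentSpace (𝓡 n) x) {c : ℝ} (hc : 0 ≤ c) :
    F ⟨x, c • v⟩ = c * F ⟨x, v⟩ := by
  rcases hc.eq_or_lt with rfl | hc
  · rw [zero_smul, hF.zero, zero_mul]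
  · exact hF.homogeneous x v c hc

lemma tangentChart_smul (hF : IsFinsler F) {x₀ : X} {z : EuclideanSpace ℝ (Fin n)}
    (hz : z ∈ (extChartAt (𝓡 n) x₀).target) (v : EuclideanSpace ℝ (Fin n)) {c : ℝ} (hc : 0 ≤ c) :
    F (tangentChart x₀ (z, c • v)) = c * F (tangentChart x₀ (z, v)) :=
  homogeneous_tangentChart hF.homogeneous hz v hc

lemma exists_tangentChart_le (hF : IsFinsler F) {x₀ : X} {K : Set (EuclideanSpace ℝ (Fin n))}
    (hK : IsCompact K) (hKt : K ⊆ (extChartAt (𝓡 n) x₀).target) :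
    ∃ M : ℝ, 0 ≤ M ∧ ∀ z ∈ K, ∀ v, F (tangentChart x₀ (z, v)) ≤ M * ‖v‖ :=
  DiffPassivity.exists_tangentChart_le hF.homogeneous
    (fun _ _ _ ↦ hF.continuous.continuousAt) hK hKt

lemma continuousOn_tangentChart (hF : IsFinsler F) (x₀ : X) :
    ContinuousOn (fun p ↦ F (tangentChart x₀ p)) ((extChartAt (𝓡 n) x₀).target ×ˢ univ) :=
  hF.continuous.comp_continuousOn (DiffPassivity.continuousOn_tangentChart x₀)

lemma exists_le_tangentChart (hF : IsFinsler F) {x₀ : X} {K : Set (EuclideanSpace ℝ (Fin n))}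
    (hK : IsCompact K) (hKt : K ⊆ (extChartAt (𝓡 n) x₀).target)
    (hpos : ∀ z ∈ K, ∀ v ≠ 0, 0 < F (tangentChart x₀ (z, v))) :
    ∃ m : ℝ, 0 < m ∧ ∀ z ∈ K, ∀ v, m * ‖v‖ ≤ F (tangentChart x₀ (z, v)) := by
  have hc : ContinuousOn (fun p ↦ F (tangentChart x₀ p)) (K ×ˢ Metric.sphere 0 1) :=
    (hF.continuousOn_tangentChart x₀).mono (prod_mono hKt (subset_univ _))
  obtain ⟨m, hm, hmF⟩ : ∃ m : ℝ, 0 < m ∧ ∀ p ∈ K ×ˢ Metric.sphere 0 1,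
      m ≤ F (tangentChart x₀ p) := by
    -- The product is empty when `K` is, or in dimension zero; any positive constant then works.
    rcases (K ×ˢ Metric.sphere (0 : EuclideanSpace ℝ (Fin n)) 1).eq_empty_or_nonempty with he | hne
    · exact ⟨1, one_pos, by simp [he]⟩
    · obtain ⟨p, hp, hmin⟩ := (hK.prod (isCompact_sphere 0 1)).exists_isMinOn hne hc
      refine ⟨_, hpos p.1 hp.1 p.2 ?_, fun q hq ↦ hmin hq⟩
      rintro h
      have := hp.2
      simp [h] at this
  refine ⟨m, hm, fun z hz v ↦ ?_⟩
  rcases eq_or_ne v 0 with rfl | hv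
  · simpa using hF.nonneg _
  · have h1 : m ≤ F (tangentChart x₀ (z, ‖v‖⁻¹ • v)) := hmF _ ⟨hz, by simp [norm_smul, hv]⟩
    have h2 := hF.tangentChart_smul (hKt hz) (‖v‖⁻¹ • v) (norm_nonneg v)
    rw [smul_inv_smul₀ (norm_ne_zero_iff.2 hv)] at h2
    rw [h2, mul_comm]
    gcongr

end IsFinsler

end Finsler

end DiffPassivity

namespace DiffPassivity

/-! ### Lengths of curves and the extended distance induced by `F` -/

section Length

open MeasureTheory

variable {n : ℕ} {X : Type*} [TopologicalSpace X] [ChartedSpace (EuclideanSpace ℝ (Fin n)) X]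

/-- The `F`-length of a curve on `[a, b]`. -/
noncomputable def lengthOn (F : TangentBundle (𝓡 n) X → ℝ) (γ : ℝ → X) (a b : ℝ) : ℝ≥0∞ :=
  ∫⁻ s in Icc a b, ENNReal.ofReal (F (velocityWithin γ univ s))

/-- The extended distance induced by `F`. -/
noncomputable def finslerEDist (F : TangentBundle (𝓡 n) X → ℝ) (x y : X) : ℝ≥0∞ :=
  ⨅ (γ : ℝ → X) (_ : ContMDiffOn 𝓘(ℝ, ℝ) (𝓡 n) 1 γ (Icc 0 1)) (_ : γ 0 = x) (_ : γ 1 = y),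
    finslerLength F γ

variable {F : TangentBundle (𝓡 n) X → ℝ}

lemma lengthOn_eq_Ioo (γ : ℝ → X) (a b : ℝ) : lengthOn F γ a b =
    ∫⁻ s in Ioo a b, ENNReal.ofReal (F (velocityWithin γ univ s)) := by
  rw [lengthOn, restrict_Ioo_eq_restrict_Icc]

/-- The two integrands differ only at the endpoints, a null set. Derivatives within `univ` make the
length additive and local; derivatives within the interval suit curves given only there. -/
lemma lengthOn_eq_velocityWithin (γ : ℝ → X) (a b : ℝ) : lengthOn F γ a b =
    ∫⁻ s in Icc a b,ENNReal.ofReal (F (velocityWithin γ (Icc a b) s)) := by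
  rw [lengthOn, ← restrict_Ioo_eq_restrict_Icc]
  refine setLIntegral_congr_fun measurableSet_Ioo fun t ht ↦ ?_
  simp only [velocityWithin]
  rw [mfderivWithin_of_mem_nhds (Icc_mem_nhds ht.1 ht.2), mfderivWithin_univ]

lemma finslerLength_eq_lengthOn (γ : ℝ → X) : finslerLength F γ = lengthOn F γ 0 1 :=
  (lengthOn_eq_velocityWithin γ 0 1).symm

lemma lengthOn_congr {γ γ' : ℝ → X} {a b : ℝ} (h : EqOn γ γ' (Ioo a b)) :
    lengthOn F γ a b = lengthOn F γ' a b := by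
  simp only [lengthOn_eq_Ioo]
  refine setLIntegral_congr_fun measurableSet_Ioo fun t ht ↦ ?_
  have h1 : γ =ᶠ[𝓝 t] γ' := by
    filter_upwards [Ioo_mem_nhds ht.1 ht.2] with s hs using h hs
  have h2 := h1.mfderiv_eq (I := 𝓘(ℝ, ℝ)) (I' := 𝓡 n)
  have h3 : γ t = γ' t := h ht
  have : velocityWithin γ univ t = velocityWithin (n := n) γ' univ t := by
    have aux : ∀ (y : X) (v w : EuclideanSpace ℝ (Fin n)), γ t = y → v = w →
        (⟨γ t, v⟩ : TangentBundle (𝓡 n) X) = ⟨y, w⟩ := by rintro y v w rfl rfl; rfl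
    simp only [velocityWithin, mfderivWithin_univ]
    exact aux _ _ _ h3 (congrArg (fun L : ℝ →L[ℝ] EuclideanSpace ℝ (Fin n) ↦ L 1) h2)
  simp only [this]

lemma lengthOn_add (γ : ℝ → X) {a b c : ℝ} (h : a ≤ b) (h' : b ≤ c) :
    lengthOn F γ a b + lengthOn F γ b c = lengthOn F γ a c := by
  have : Icc a c = Icc a b ∪ Ioc b c := (Icc_union_Ioc_eq_Icc h h').symm
  rw [lengthOn, lengthOn, lengthOn, this, lintegral_union measurableSet_Ioc,
    restrict_Ioc_eq_restrict_Icc]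
  exact disjoint_iff_forall_ne.mpr (fun a ha b hb ↦ (ha.2.trans_lt hb.1).ne)

lemma finslerEDist_le_finslerLength {γ : ℝ → X} {x y : X}
    (hγ : ContMDiffOn 𝓘(ℝ, ℝ) (𝓡 n) 1 γ (Icc 0 1)) (h0 : γ 0 = x) (h1 : γ 1 = y) :
    finslerEDist F x y ≤ finslerLength F γ :=
  iInf₂_le_of_le γ hγ (iInf₂_le_of_le h0 h1 le_rfl)

lemma exists_finslerLength_lt {x y : X} {r : ℝ≥0∞} (h : finslerEDist F x y < r) :
    ∃ γ : ℝ → X, ContMDiffOn 𝓘(ℝ, ℝ) (𝓡 n) 1 γ (Icc 0 1) ∧ γ 0 = x ∧ γ 1 = y ∧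
      finslerLength F γ < r := by
  simpa only [finslerEDist, iInf_lt_iff, exists_prop] using h

variable [IsManifold (𝓡 n) ∞ X]

/-- Positive homogeneity turns the factor `f' ≥ 0` of the chain rule into the Jacobian of the
substitution. Since `F` need not be symmetric, `f` must preserve orientation; it may be constant on
intervals. -/
lemma IsFinsler.lengthOn_comp_of_monotoneOn (hF : IsFinsler F) {γ : ℝ → X} {f : ℝ → ℝ} {a b : ℝ}
    (h : a < b) (hf : MonotoneOn f (Icc a b)) (h'f : DifferentiableOn ℝ f (Icc a b))
    (hγ : MDifferentiableOn 𝓘(ℝ, ℝ) (𝓡 n) γ (Icc (f a) (f b))) :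
    lengthOn F (γ ∘ f) a b = lengthOn F γ (f a) (f b) := by
  have f_im : f '' (Icc a b) = Icc (f a) (f b) := h'f.continuousOn.image_Icc_of_monotoneOn h.le hf
  simp only [lengthOn_eq_velocityWithin, ← f_im]
  have B (t) (ht : t ∈ Icc a b) : HasDerivWithinAt f (derivWithin f (Icc a b) t) (Icc a b) t :=
    (h'f t ht).hasDerivWithinAt
  rw [lintegral_image_eq_lintegral_deriv_mul_of_monotoneOn measurableSet_Icc B hf]
  refine setLIntegral_congr_fun measurableSet_Icc fun t ht ↦ ?_
  rw [← f_im] at hγ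
  have h1 := (hγ _ (mem_image_of_mem f ht)).hasMFDerivWithinAt.comp t
    (hasMFDerivWithinAt_iff_hasFDerivWithinAt.2 (B t ht).hasFDerivWithinAt)
    (subset_preimage_image f (Icc a b))
  have h2 := h1.mfderivWithin (uniqueMDiffWithinAt_iff_uniqueDiffWithinAt.2 (uniqueDiffOn_Icc h t ht))
  have h0 : 0 ≤ derivWithin f (Icc a b) t := hf.derivWithin_nonneg
  have h3 : velocityWithin (n := n) (γ ∘ f) (Icc a b) t =
      ⟨γ (f t), derivWithin f (Icc a b) t • (velocityWithin (n := n) γ (f '' Icc a b) (f t)).2⟩ := by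
    have h4 : mfderivWithin 𝓘(ℝ, ℝ) (𝓡 n) (γ ∘ f) (Icc a b) t (1 : ℝ) =
        mfderivWithin 𝓘(ℝ, ℝ) (𝓡 n) γ (f '' Icc a b) (f t)
          (derivWithin f (Icc a b) t • (1 : ℝ)) := by
      rw [h2]
      exact congrArg (mfderivWithin 𝓘(ℝ, ℝ) (𝓡 n) γ (f '' Icc a b) (f t))
        (show ContinuousLinearMap.toSpanSingleton ℝ (derivWithin f (Icc a b) t) (1 : ℝ) =
          derivWithin f (Icc a b) t • (1 : ℝ) by simp)
    exact congrArg (Bundle.TotalSpace.mk (γ (f t))) (h4.trans (map_smul _ _ _))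
  have h5 : F (velocityWithin (γ ∘ f) (Icc a b) t) =
      derivWithin f (Icc a b) t * F (velocityWithin γ (f '' Icc a b) (f t)) :=
    (congrArg F h3).trans (hF.smul _ _ h0)
  rw [h5, ENNReal.ofReal_mul h0]

lemma finslerEDist_self (hF : IsFinsler F) (x : X) : finslerEDist F x x = 0 := by
  refine le_antisymm ((finslerEDist_le_finslerLength (γ := fun _ ↦ x) contMDiffOn_const rfl rfl).trans
    ?_) bot_le
  have : ∀ s : ℝ, velocityWithin (n := n) (fun _ : ℝ ↦ x) (Icc 0 1) s = ⟨x, 0⟩ := by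
    intro s
    rw [velocityWithin, mfderivWithin_const]
    rfl
  rw [finslerLength_eq_lengthOn, lengthOn_eq_velocityWithin]
  simp [this, hF.zero]

/-- Concatenation of `C^1` curves may create a corner. Both curves are first reparametrized so as to
stand still near the junction, which leaves their lengths unchanged. -/
lemma finslerEDist_triangle (hF : IsFinsler F) (x y z : X) :
    finslerEDist F x z ≤ finslerEDist F x y + finslerEDist F y z := by
  refine le_of_forall_gt fun r hr ↦ ?_
  obtain ⟨u, hu, v, hv, huv⟩ := ENNReal.exists_add_lt_of_add_lt hr
  obtain ⟨γ₁, hγ₁, h₁0, h₁1, hl₁⟩ := exists_finslerLength_lt hu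
  obtain ⟨γ₂, hγ₂, h₂0, h₂1, hl₂⟩ := exists_finslerLength_lt hv
  -- `η₁` has reached `1` by time `1/4` and `η₂` stays `0` until `3/4`, so both pieces equal `y`
  -- around the junction `1/2`.
  let η₁ : ℝ → ℝ := fun t ↦ Real.smoothTransition (4 * t)
  let η₂ : ℝ → ℝ := fun t ↦ Real.smoothTransition (4 * t - 3)
  have hη₁ : ContDiff ℝ 1 η₁ := by fun_prop
  have hη₂ : ContDiff ℝ 1 η₂ := by fun_prop
  have hη₁m : Monotone η₁ := fun s t hst ↦ Real.smoothTransition.monotone (by linarith)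
  have hη₂m : Monotone η₂ := fun s t hst ↦ Real.smoothTransition.monotone (by linarith)
  have hη₁0 : η₁ 0 = 0 := Real.smoothTransition.zero_of_nonpos (by norm_num)
  have hη₁1 : ∀ t, 1 / 4 ≤ t → η₁ t = 1 := fun t ht ↦
    Real.smoothTransition.one_of_one_le (by linarith)
  have hη₂0 : ∀ t, t ≤ 3 / 4 → η₂ t = 0 := fun t ht ↦
    Real.smoothTransition.zero_of_nonpos (by linarith)
  have hη₂1 : η₂ 1 = 1 := Real.smoothTransition.one_of_one_le (by norm_num)
  have hs₁ : ContMDiff 𝓘(ℝ, ℝ) (𝓡 n) 1 (γ₁ ∘ η₁) := by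
    rw [← contMDiffOn_univ]
    refine hγ₁.comp hη₁.contMDiff.contMDiffOn fun t _ ↦ ?_
    exact ⟨Real.smoothTransition.nonneg _, Real.smoothTransition.le_one _⟩
  have hs₂ : ContMDiff 𝓘(ℝ, ℝ) (𝓡 n) 1 (γ₂ ∘ η₂) := by
    rw [← contMDiffOn_univ]
    refine hγ₂.comp hη₂.contMDiff.contMDiffOn fun t _ ↦ ?_
    exact ⟨Real.smoothTransition.nonneg _, Real.smoothTransition.le_one _⟩
  let γ := piecewise (Iic (1 / 2 : ℝ)) (γ₁ ∘ η₁) (γ₂ ∘ η₂)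
  have hγ : ContMDiff 𝓘(ℝ, ℝ) (𝓡 n) 1 γ := by
    refine ContMDiff.piecewise_Iic hs₁ hs₂ ?_
    filter_upwards [Icc_mem_nhds (show (1 / 4 : ℝ) < 1 / 2 by norm_num)
      (show (1 / 2 : ℝ) < 3 / 4 by norm_num)] with t ht
    simp [hη₁1 t ht.1, hη₂0 t ht.2, h₁1, h₂0]
  have hle : finslerEDist F x z ≤ finslerLength F γ := by
    refine finslerEDist_le_finslerLength hγ.contMDiffOn ?_ ?_
    · simp [γ, hη₁0, h₁0]
    · have : (1 : ℝ) ∉ Iic (1 / 2) := by norm_num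
      exact (piecewise_eq_of_notMem _ _ _ this).trans (by simp [hη₂1, h₂1])
  refine hle.trans_lt (lt_of_le_of_lt (le_of_eq ?_) ((ENNReal.add_lt_add hl₁ hl₂).trans huv))
  rw [finslerLength_eq_lengthOn, finslerLength_eq_lengthOn, finslerLength_eq_lengthOn,
    ← lengthOn_add γ (b := 1 / 2) (by norm_num) (by norm_num)]
  congr 1
  · have h1 : lengthOn F γ 0 (1 / 2) = lengthOn F (γ₁ ∘ η₁) 0 (1 / 2) :=
      lengthOn_congr fun t ht ↦ piecewise_eq_of_mem _ _ _ ht.2.le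
    rw [h1, hF.lengthOn_comp_of_monotoneOn (by norm_num) (hη₁m.monotoneOn _)
      (hη₁.differentiable one_ne_zero).differentiableOn, hη₁0, hη₁1 _ (by norm_num)]
    rw [hη₁0, hη₁1 _ (by norm_num)]
    exact hγ₁.mdifferentiableOn one_ne_zero
  · have h1 : lengthOn F γ (1 / 2) 1 = lengthOn F (γ₂ ∘ η₂) (1 / 2) 1 :=
      lengthOn_congr fun t ht ↦ piecewise_eq_of_notMem _ _ _ (not_le.2 ht.1)
    rw [h1, hF.lengthOn_comp_of_monotoneOn (by norm_num) (hη₂m.monotoneOn _)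
      (hη₂.differentiable one_ne_zero).differentiableOn, hη₂1, hη₂0 _ (by norm_num)]
    rw [hη₂1, hη₂0 _ (by norm_num)]
    exact hγ₂.mdifferentiableOn one_ne_zero

end Length

end DiffPassivity

namespace DiffPassivity

/-! ### Mean value inequality and upper bounds for the distance -/

section LocalDistance

open MeasureTheory

/-- A function whose upper right Dini derivative is bounded by a continuous function `φ` grows at
most by the integral of `φ`. -/
lemma sub_le_integral_of_eventually_le {D φ : ℝ → ℝ} (hD : ContinuousOn D (Icc 0 1))
    (hφ : ContinuousOn φ (Icc 0 1))
    (h : ∀ s ∈ Ico (0 : ℝ) 1, ∀ r > φ s, ∀ᶠ t in 𝓝[>] s, D t - D s ≤ r * (t - s)) :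
    D 1 - D 0 ≤ ∫ s in (0 : ℝ)..1, φ s := by
  -- A continuous extension to the line has a primitive differentiable everywhere, endpoints
  -- included.
  set ψ : ℝ → ℝ := IccExtend zero_le_one ((Icc (0 : ℝ) 1).domRestrict φ) with hψdef
  have hψ : Continuous ψ := (continuousOn_iff_continuous_domRestrict.1 hφ).Icc_extend'
  have hψφ : ∀ s ∈ Icc (0 : ℝ) 1, ψ s = φ s := fun s hs ↦ by
    rw [hψdef, IccExtend_of_mem _ _ hs]; rfl
  have hint : ∫ s in (0 : ℝ)..1, φ s = ∫ s in (0 : ℝ)..1, ψ s :=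
    intervalIntegral.integral_congr fun s hs ↦ by
      rw [uIcc_of_le zero_le_one] at hs
      exact (hψφ s hs).symm
  have hB : ∀ s, HasDerivAt (fun s ↦ D 0 + ∫ τ in (0 : ℝ)..s, ψ τ) (ψ s) s := fun s ↦
    ((hψ.integral_hasStrictDerivAt 0 s).hasDerivAt).const_add _
  have := image_le_of_liminf_slope_right_le_deriv_boundary hD (B := fun s ↦ D 0 +
    ∫ τ in (0 : ℝ)..s, ψ τ) (B' := ψ) (by simp) (fun s _ ↦ (hB s).continuousAt.continuousWithinAt)
    (fun s _ ↦ (hB s).hasDerivWithinAt) (fun s hs r hr ↦ ?_) (right_mem_Icc.2 zero_le_one)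
  · rw [hint]
    linarith
  · obtain ⟨q, hq, hqr⟩ := exists_between hr
    rw [hψφ s ⟨hs.1, hs.2.le⟩] at hq
    refine Filter.Eventually.frequently ?_
    filter_upwards [h s hs q hq, self_mem_nhdsWithin] with t ht hst
    have hst' : 0 < t - s := sub_pos.2 hst
    rw [slope_def_field, div_lt_iff₀ hst']
    exact ht.trans_lt (by gcongr)

variable {n : ℕ} {X : Type*} [TopologicalSpace X] [ChartedSpace (EuclideanSpace ℝ (Fin n)) X]
  [IsManifold (𝓡 n) ∞ X] {F : TangentBundle (𝓡 n) X → ℝ}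

lemma IsFinsler.continuousOn_velocityWithin (hF : IsFinsler F) {γ : ℝ → X}
    (hγ : ContMDiffOn 𝓘(ℝ, ℝ) (𝓡 n) 1 γ (Icc 0 1)) :
    ContinuousOn (fun s ↦ F (velocityWithin γ (Icc 0 1) s)) (Icc 0 1) := by
  have h1 := hγ.continuousOn_tangentMapWithin le_rfl
    (uniqueMDiffOn_iff_uniqueDiffOn.2 (uniqueDiffOn_Icc zero_lt_one))
  have h2 : Continuous (fun s : ℝ ↦ (⟨s, (1 : ℝ)⟩ : TangentBundle 𝓘(ℝ, ℝ) ℝ)) := by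
    have : Continuous ((tangentBundleModelSpaceHomeomorph 𝓘(ℝ, ℝ)).symm ∘
      fun s : ℝ ↦ ((s, (1 : ℝ)) : ModelProd ℝ ℝ)) :=
      (tangentBundleModelSpaceHomeomorph 𝓘(ℝ, ℝ)).symm.continuous.comp
        (by exact Continuous.prodMk continuous_id continuous_const)
    exact this
  exact hF.continuous.comp_continuousOn (h1.comp h2.continuousOn fun s hs ↦ hs)

lemma IsFinsler.finslerLength_eq (hF : IsFinsler F) {γ : ℝ → X}
    (hγ : ContMDiffOn 𝓘(ℝ, ℝ) (𝓡 n) 1 γ (Icc 0 1)) :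
    finslerLength F γ =
      ENNReal.ofReal (∫ s in (0 : ℝ)..1, F (velocityWithin γ (Icc 0 1) s)) := by
  have hc := hF.continuousOn_velocityWithin hγ
  rw [finslerLength_eq_lengthOn, lengthOn_eq_velocityWithin,
    intervalIntegral.integral_of_le zero_le_one, ← integral_Icc_eq_integral_Ioc,
    ofReal_integral_eq_lintegral_ofReal (hc.integrableOn_compact isCompact_Icc)
      (Filter.Eventually.of_forall fun s ↦ hF.nonneg _)]

/-- The straight segment in the chart is a competitor, with constant velocity `z' - z`. -/
lemma finslerEDist_le_of_segment {x₀ : X}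
    {z z' : EuclideanSpace ℝ (Fin n)} (hseg : segment ℝ z z' ⊆ (extChartAt (𝓡 n) x₀).target)
    {B : ℝ} (hB : ∀ y ∈ segment ℝ z z', F (tangentChart x₀ (y, z' - z)) ≤ B) :
    finslerEDist F ((extChartAt (𝓡 n) x₀).symm z) ((extChartAt (𝓡 n) x₀).symm z') ≤
      ENNReal.ofReal B := by
  set φ := extChartAt (𝓡 n) x₀ with hφ
  let ℓ : ℝ → EuclideanSpace ℝ (Fin n) := fun s ↦ AffineMap.lineMap z z' s
  have hℓ : ∀ s ∈ Icc (0 : ℝ) 1, ℓ s ∈ segment ℝ z z' := fun s hs ↦ by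
    rw [segment_eq_image_lineMap]; exact mem_image_of_mem _ hs
  have hℓd : ∀ s, HasDerivAt ℓ (z' - z) s := fun s ↦ AffineMap.hasDerivAt_lineMap
  have hℓc : ContDiff ℝ 1 ℓ := by
    have : ℓ = fun s : ℝ ↦ s • (z' - z) + z := by
      ext1 s; simp [ℓ, AffineMap.lineMap_apply]
    rw [this]; fun_prop
  have hγ : ContMDiffOn 𝓘(ℝ, ℝ) (𝓡 n) 1 (φ.symm ∘ ℓ) (Icc 0 1) :=
    ((contMDiffOn_extChartAt_symm (n := ∞) x₀).of_le (by exact_mod_cast le_top)).comp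
      hℓc.contMDiff.contMDiffOn fun s hs ↦ hseg (hℓ s hs)
  have hle : ∀ s ∈ Icc (0 : ℝ) 1, F (velocityWithin (φ.symm ∘ ℓ) (Icc 0 1) s) ≤ B := by
    intro s hs
    have hr : φ ((φ.symm ∘ ℓ) s) = ℓ s := φ.right_inv (hseg (hℓ s hs))
    rw [← tangentChart_velocityWithin (x₀ := x₀) (v := z' - z) (uniqueDiffOn_Icc zero_lt_one s hs)
      (hγ.mdifferentiableOn one_ne_zero s hs) (φ.map_target (hseg (hℓ s hs))), ← hφ, hr]
    · exact hB _ (hℓ s hs)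
    · exact (hℓd s).hasDerivWithinAt.congr_of_mem
        (fun τ hτ ↦ φ.right_inv (hseg (hℓ τ hτ))) hs
  refine (finslerEDist_le_finslerLength hγ (by simp [ℓ]) (by simp [ℓ])).trans ?_
  rw [finslerLength_eq_lengthOn, lengthOn_eq_velocityWithin]
  refine (setLIntegral_mono' measurableSet_Icc fun s hs ↦
    ENNReal.ofReal_le_ofReal (hle s hs)).trans ?_
  simp

lemma IsFinsler.exists_finslerEDist_le (hF : IsFinsler F) (x : X) :
    ∃ M : ℝ, ∀ᶠ y in 𝓝 x,
      finslerEDist F x y ≤ ENNReal.ofReal (M * dist (extChartAt (𝓡 n) x y) (extChartAt (𝓡 n) x x)) ∧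
      finslerEDist F y x ≤
        ENNReal.ofReal (M * dist (extChartAt (𝓡 n) x y) (extChartAt (𝓡 n) x x)) := by
  set φ := extChartAt (𝓡 n) x
  have hx : x ∈ φ.source := mem_extChartAt_source x
  obtain ⟨ρ, hρ, hρt⟩ := Metric.nhds_basis_closedBall.mem_iff.1
    ((isOpen_extChartAt_target x).mem_nhds (φ.map_source hx))
  obtain ⟨M, hM0, hM⟩ := hF.exists_tangentChart_le (isCompact_closedBall (φ x) ρ) hρt
  refine ⟨M, ?_⟩
  filter_upwards [extChartAt_source_mem_nhds (I := 𝓡 n) x,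
    (continuousAt_extChartAt (I := 𝓡 n) x) (Metric.closedBall_mem_nhds _ hρ)] with y hy hy'
  have hc := (convex_closedBall (φ x) ρ)
  have h1 : segment ℝ (φ x) (φ y) ⊆ Metric.closedBall (φ x) ρ :=
    hc.segment_subset (Metric.mem_closedBall_self hρ.le) hy'
  have h2 : segment ℝ (φ y) (φ x) ⊆ Metric.closedBall (φ x) ρ :=
    hc.segment_subset hy' (Metric.mem_closedBall_self hρ.le)
  constructor
  · have := finslerEDist_le_of_segment (h1.trans hρt) (fun z hz ↦ hM z (h1 hz) (φ y - φ x))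
    rwa [φ.left_inv hx, φ.left_inv hy, ← dist_eq_norm] at this
  · have := finslerEDist_le_of_segment (h2.trans hρt) (fun z hz ↦ hM z (h2 hz) (φ x - φ y))
    rwa [φ.left_inv hx, φ.left_inv hy, ← dist_eq_norm, dist_comm] at this

lemma IsFinsler.tendsto_finslerEDist (hF : IsFinsler F) (x : X) :
    Filter.Tendsto (fun y ↦ finslerEDist F x y) (𝓝 x) (𝓝 0) ∧
      Filter.Tendsto (fun y ↦ finslerEDist F y x) (𝓝 x) (𝓝 0) := by
  obtain ⟨M, hM⟩ := hF.exists_finslerEDist_le x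
  have h0 : Filter.Tendsto (fun y ↦ ENNReal.ofReal
      (M * dist (extChartAt (𝓡 n) x y) (extChartAt (𝓡 n) x x))) (𝓝 x) (𝓝 0) := by
    have h1 : ContinuousAt (fun y ↦ ENNReal.ofReal
      (M * dist (extChartAt (𝓡 n) x y) (extChartAt (𝓡 n) x x))) x :=
      (ENNReal.continuous_ofReal.continuousAt).comp (continuousAt_const.mul
        ((continuousAt_extChartAt (I := 𝓡 n) x).dist continuousAt_const))
    simpa [ContinuousAt] using h1
  exact ⟨tendsto_of_tendsto_of_tendsto_of_le_of_le' tendsto_const_nhds h0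
      (Filter.Eventually.of_forall fun _ ↦ zero_le) (hM.mono fun _ h ↦ h.1),
    tendsto_of_tendsto_of_tendsto_of_le_of_le' tendsto_const_nhds h0
      (Filter.Eventually.of_forall fun _ ↦ zero_le) (hM.mono fun _ h ↦ h.2)⟩

/-- The distance grows along a differentiable curve at most at the rate given by `F`. -/
lemma IsFinsler.eventually_finslerEDist_le (hF : IsFinsler F) {c : ℝ → X} {s : ℝ}
    (hs : s ∈ Ico (0 : ℝ) 1) (hc : MDifferentiableWithinAt 𝓘(ℝ, ℝ) (𝓡 n) c (Icc 0 1) s)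
    {r : ℝ} (hr : F (velocityWithin c (Icc 0 1) s) < r) :
    ∀ᶠ t in 𝓝[>] s, finslerEDist F (c s) (c t) ≤ ENNReal.ofReal (r * (t - s)) := by
  set x := c s with hx
  set φ := extChartAt (𝓡 n) x with hφ
  have hxs : x ∈ φ.source := mem_extChartAt_source x
  have hIcc : Icc (0 : ℝ) 1 ∈ 𝓝[>] s := Icc_mem_nhdsGT_of_mem hs
  have hd := HasMFDerivWithinAt.hasDerivWithinAt_extChartAt hc.hasMFDerivWithinAt hxs
  rw [← hφ] at hd
  set v := vecCoord x (mfderivWithin 𝓘(ℝ, ℝ) (𝓡 n) c (Icc 0 1) s (1 : ℝ)) with hv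
  have hvel : tangentChart x (φ x, v) = velocityWithin c (Icc 0 1) s :=
    tangentChart_velocityWithin (uniqueDiffOn_Icc zero_lt_one s ⟨hs.1, hs.2.le⟩) hc hxs hd
  have hcont : ContinuousAt (fun p ↦ F (tangentChart x p)) (φ x, v) :=
    (hF.continuousOn_tangentChart x).continuousAt
      (((isOpen_extChartAt_target x).prod isOpen_univ).mem_nhds ⟨φ.map_source hxs, trivial⟩)
  -- By continuity `F < r` for base points near `φ x` and vectors near `v`. For `t` close to `s`,
  -- the segment from `φ x` to `φ (c t)` has such base points, and its velocity is `t - s` times a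
  -- slope close to `v`.
  have hev : ∀ᶠ p in 𝓝 (φ x, v), F (tangentChart x p) < r :=
    hcont (Iio_mem_nhds (show F (tangentChart x (φ x, v)) < r by rw [hvel]; exact hr))
  rw [nhds_prod_eq] at hev
  obtain ⟨P, hP, Q, hQ, hPQ⟩ := Filter.eventually_prod_iff.1 hev
  obtain ⟨ρ, hρ, hρt⟩ := Metric.nhds_basis_ball.mem_iff.1
    (Filter.inter_mem hP ((isOpen_extChartAt_target x).mem_nhds (φ.map_source hxs)))
  have hd' : HasDerivWithinAt (fun τ ↦ φ (c τ)) v (Ioi s) s := hd.mono_of_mem_nhdsWithin hIcc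
  have hslope := (hasDerivWithinAt_iff_tendsto_slope' (self_notMem_Ioi)).1 hd'
  have hcs : ContinuousWithinAt c (Ioi s) s := hc.continuousWithinAt.mono_of_mem_nhdsWithin hIcc
  filter_upwards [hslope hQ, hd'.continuousWithinAt (Metric.ball_mem_nhds _ hρ),
    hcs (extChartAt_source_mem_nhds (I := 𝓡 n) x), self_mem_nhdsWithin] with t h1 h2 h3 h4
  have h4' : 0 < t - s := sub_pos.2 h4
  have hseg : segment ℝ (φ x) (φ (c t)) ⊆ Metric.ball (φ x) ρ :=
    (convex_ball _ _).segment_subset (Metric.mem_ball_self hρ) h2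
  have := finslerEDist_le_of_segment (F := F) (x₀ := x) (B := r * (t - s))
    (hseg.trans fun y hy ↦ (hρt hy).2) (fun y hy ↦ ?_)
  · rwa [← hφ, φ.left_inv hxs, φ.left_inv h3] at this
  · have h5 : φ (c t) - φ x = (t - s) • slope (fun τ ↦ φ (c τ)) s t := by
      rw [sub_smul_slope]
      rfl
    rw [h5, hF.tangentChart_smul (hρt (hseg hy)).2 _ h4'.le, mul_comm]
    exact mul_le_mul_of_nonneg_right (hPQ (hρt (hseg hy)).1 h1).le h4'.le

end LocalDistance

end DiffPassivity

namespace DiffPassivity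

/-! ### Lower bounds for the distance -/

section Separation

variable {n : ℕ} {X : Type*} [TopologicalSpace X] [ChartedSpace (EuclideanSpace ℝ (Fin n)) X]
  [IsManifold (𝓡 n) ∞ X] {F : TangentBundle (𝓡 n) X → ℝ}

/-- `F` is positive definite at all points close to, but different from, a given point. -/
lemma IsFinsler.eventually_pos (hF : IsFinsler F) (x : X) :
    ∀ᶠ z in 𝓝[≠] (extChartAt (𝓡 n) x x), ∀ v : EuclideanSpace ℝ (Fin n), v ≠ 0 →
      0 < F (tangentChart x (z, v)) := by
  obtain ⟨Ω, hΩ, hpos⟩ := hF.isolated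
  set φ := extChartAt (𝓡 n) x with hφ
  have hxs : x ∈ φ.source := mem_extChartAt_source x
  have htgt : φ.target ∈ 𝓝 (φ x) := (isOpen_extChartAt_target x).mem_nhds (φ.map_source hxs)
  have hpos' : ∀ z ∈ φ.target, φ.symm z ∉ Ω → ∀ v : EuclideanSpace ℝ (Fin n), v ≠ 0 →
      0 < F (tangentChart x (z, v)) := by
    intro z hz hzΩ v hv
    obtain ⟨w, hw, hw'⟩ := exists_tangentChart_eq_mk hz v
    have h1 := hw' 1
    rw [one_smul, one_smul] at h1
    rw [h1]
    refine hpos _ hzΩ w ?_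
    rintro rfl
    exact hv (hw.symm.trans (vecCoord_zero _ _))
  by_cases hx : x ∈ Ω
  · obtain ⟨U, hU, hUΩ⟩ := nhds_inter_eq_singleton_of_mem_discrete
      (isDiscrete_iff_discreteTopology.2 hΩ) hx
    have hsymm : ∀ᶠ z in 𝓝 (φ x), φ.symm z ∈ U := by
      have := continuousAt_extChartAt_symm (I := 𝓡 n) x
      refine this ?_
      rwa [extChartAt_to_inv]
    rw [eventually_nhdsWithin_iff]
    filter_upwards [hsymm, htgt] with z hzU hzt hzne
    refine hpos' z hzt fun hzΩ ↦ hzne ?_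
    have : φ.symm z ∈ U ∩ Ω := ⟨hzU, hzΩ⟩
    rw [hUΩ, mem_singleton_iff] at this
    rw [mem_singleton_iff, ← this, φ.right_inv hzt]
  -- `Ω` need not be closed and may accumulate at `x`. Positivity is therefore spread from `x`
  -- itself, by continuity of `F` and compactness of the unit sphere.
  · refine Filter.Eventually.filter_mono nhdsWithin_le_nhds ?_
    have key : ∀ᶠ z in 𝓝 (φ x), ∀ v ∈ Metric.sphere (0 : EuclideanSpace ℝ (Fin n)) 1,
        0 < F (tangentChart x (z, v)) := by
      refine (isCompact_sphere _ _).eventually_forall_of_forall_eventually fun v hv ↦ ?_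
      have hcont : ContinuousAt (fun p ↦ F (tangentChart x p)) (φ x, v) :=
        (hF.continuousOn_tangentChart x).continuousAt
          (((isOpen_extChartAt_target x).prod isOpen_univ).mem_nhds ⟨φ.map_source hxs, trivial⟩)
      refine hcont (Ioi_mem_nhds ?_)
      refine hpos' _ (φ.map_source hxs) (by rwa [φ.left_inv hxs]) v ?_
      rintro rfl
      simp at hv
    filter_upwards [key, htgt] with z hz hzt v hv
    have h1 := hz (‖v‖⁻¹ • v) (by simp [norm_smul, hv])
    rw [hF.tangentChart_smul hzt _ (by positivity)] at h1
    exact pos_of_mul_pos_right h1 (by positivity)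

/-- If `F` dominates `m` times the Euclidean norm on an annulus of a chart, then crossing the
annulus costs at least `m` times its width. -/
lemma IsFinsler.le_finslerLength_of_annulus [T2Space X] (hF : IsFinsler F) {x : X} {r m : ℝ}
    (hr : 0 < r) (hm : 0 < m)
    (hrt : Metric.closedBall (extChartAt (𝓡 n) x x) r ⊆ (extChartAt (𝓡 n) x).target)
    (hF' : ∀ z ∈ Metric.closedBall (extChartAt (𝓡 n) x x) r, r / 2 ≤ dist z (extChartAt (𝓡 n) x x) →
      ∀ v, m * ‖v‖ ≤ F (tangentChart x (z, v)))
    {y y' : X} (hy : (y = x ∧ y' ∉ (extChartAt (𝓡 n) x).symm ''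
        Metric.closedBall (extChartAt (𝓡 n) x x) r) ∨
      (y' = x ∧ y ∉ (extChartAt (𝓡 n) x).symm '' Metric.closedBall (extChartAt (𝓡 n) x x) r)) :
    ENNReal.ofReal (m * (r / 2)) ≤ finslerEDist F y y' := by
  classical
  set φ := extChartAt (𝓡 n) x with hφ
  have hxs : x ∈ φ.source := mem_extChartAt_source x
  set K := φ.symm '' Metric.closedBall (φ x) r with hK
  have hKc : IsClosed K := ((isCompact_closedBall _ _).image_of_continuousOn
    ((continuousOn_extChartAt_symm x).mono hrt)).isClosed
  -- `h` is the chart distance to the centre clipped to `[r/2, r]`, and `r` outside the chart. It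
  -- varies only across the annulus, where `F` controls the speed, and is continuous because `K` is
  -- closed.
  let g : X → ℝ := fun p ↦ min r (max (r / 2) (dist (φ p) (φ x)))
  let h : X → ℝ := fun p ↦ if p ∈ φ.source then g p else r
  have hin : ∀ p ∈ φ.source, h p = g p := fun p hp ↦ if_pos hp
  have hout : ∀ p ∉ K, h p = r := by
    intro p hp
    by_cases hps : p ∈ φ.source
    · rw [hin p hps]
      refine min_eq_left (le_max_of_le_right ?_)
      by_contra hlt
      exact hp ⟨φ p, Metric.mem_closedBall.2 (not_le.1 hlt).le, φ.left_inv hps⟩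
    · exact if_neg hps
  have hKs : K ⊆ φ.source := by
    rintro _ ⟨z, hz, rfl⟩
    exact φ.map_target (hrt hz)
  have hnhds : ∀ p ∈ φ.source, φ.source ∈ 𝓝 p := fun p hp ↦ (isOpen_extChartAt_source x).mem_nhds hp
  have hφc : ∀ p ∈ φ.source, ContinuousAt φ p := fun p hp ↦ continuousAt_extChartAt' hp
  have hcont : Continuous h := by
    rw [continuous_iff_continuousAt]
    intro p
    by_cases hp : p ∈ φ.source
    · have : ContinuousAt g p :=
        continuousAt_const.min (continuousAt_const.max ((hφc p hp).dist continuousAt_const))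
      refine this.congr ?_
      filter_upwards [hnhds p hp] with q hq using (hin q hq).symm
    · have : ContinuousAt (fun _ : X ↦ r) p := continuousAt_const
      refine this.congr ?_
      filter_upwards [hKc.isOpen_compl.mem_nhds fun hpK ↦ hp (hKs hpK)] with q hq
      exact (hout q hq).symm
  have hglip : ∀ p q, |g p - g q| ≤ ‖φ p - φ q‖ := by
    intro p q
    have h1 := abs_min_sub_min_le_max r (max (r / 2) (dist (φ p) (φ x))) r
      (max (r / 2) (dist (φ q) (φ x)))
    have h2 := abs_max_sub_max_le_max (r / 2) (dist (φ p) (φ x)) (r / 2) (dist (φ q) (φ x))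
    have h3 := abs_dist_sub_le (φ p) (φ q) (φ x)
    have h0 : ∀ a : ℝ, max 0 |a| = |a| := fun a ↦ max_eq_right (abs_nonneg a)
    rw [sub_self, abs_zero, h0] at h1 h2
    rw [← dist_eq_norm]
    exact h1.trans (h2.trans h3)
  -- Outside `K`, and inside the half ball, `h ∘ γ` is locally constant to the right; on the annulus
  -- `h` is 1-Lipschitz in the chart and the speed there is at most `F / m`.
  have hslope : ∀ γ : ℝ → X, ContMDiffOn 𝓘(ℝ, ℝ) (𝓡 n) 1 γ (Icc 0 1) →
      ∀ s ∈ Ico (0 : ℝ) 1, ∀ q > m⁻¹ * F (velocityWithin γ (Icc 0 1) s), ∀ᶠ t in 𝓝[>] s,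
        |h (γ t) - h (γ s)| ≤ q * (t - s) := by
    intro γ hγ s hs q hq
    have hIcc : Icc (0 : ℝ) 1 ∈ 𝓝[>] s := Icc_mem_nhdsGT_of_mem hs
    have hq0 : 0 < q := lt_of_le_of_lt (mul_nonneg (by positivity) (hF.nonneg _)) hq
    have hγs := hγ.mdifferentiableOn one_ne_zero s ⟨hs.1, hs.2.le⟩
    have hγc : ContinuousWithinAt γ (Ioi s) s := hγs.continuousWithinAt.mono_of_mem_nhdsWithin hIcc
    have hconst : (∀ᶠ t in 𝓝[>] s, h (γ t) = h (γ s)) →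
        ∀ᶠ t in 𝓝[>] s, |h (γ t) - h (γ s)| ≤ q * (t - s) := by
      intro hev
      filter_upwards [hev, self_mem_nhdsWithin] with t ht hst
      rw [ht, sub_self, abs_zero]
      exact mul_nonneg hq0.le (sub_pos.2 hst).le
    by_cases hsK : γ s ∈ K
    swap
    · refine hconst ?_
      filter_upwards [hγc (hKc.isOpen_compl.mem_nhds hsK)] with t ht
      rw [hout _ ht, hout _ hsK]
    have hss := hKs hsK
    have hsrc := hγc (hnhds _ hss)
    have hzK : φ (γ s) ∈ Metric.closedBall (φ x) r := by
      obtain ⟨z, hz, hzs⟩ := hsK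
      rw [← hzs, φ.right_inv (hrt hz)]
      exact hz
    by_cases hsr : dist (φ (γ s)) (φ x) < r / 2
    · refine hconst ?_
      have hcomp : ContinuousWithinAt (fun t ↦ φ (γ t)) (Ioi s) s :=
        (hφc _ hss).comp_continuousWithinAt hγc
      have hg : ∀ p, dist (φ p) (φ x) < r / 2 → g p = r / 2 := by
        intro p hp
        have : max (r / 2) (dist (φ p) (φ x)) = r / 2 := max_eq_left hp.le
        simp only [g, this]
        exact min_eq_right (by linarith)
      filter_upwards [hsrc, hcomp (Metric.isOpen_ball.mem_nhds (Metric.mem_ball.2 hsr))]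
        with t ht ht'
      rw [hin _ ht, hin _ hss, hg _ ht', hg _ hsr]
    · have hd := HasMFDerivWithinAt.hasDerivWithinAt_extChartAt hγs.hasMFDerivWithinAt hss
      set v := vecCoord x (mfderivWithin 𝓘(ℝ, ℝ) (𝓡 n) γ (Icc 0 1) s (1 : ℝ)) with hv
      have hvel : tangentChart x (φ (γ s), v) = velocityWithin γ (Icc 0 1) s :=
        tangentChart_velocityWithin (uniqueDiffOn_Icc zero_lt_one s ⟨hs.1, hs.2.le⟩) hγs hss hd
      have hvq : ‖v‖ < q := by
        refine lt_of_le_of_lt ?_ hq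
        rw [← hvel, le_inv_mul_iff₀ hm]
        exact hF' _ hzK (not_lt.1 hsr) v
      have hd' := (hd.mono_of_mem_nhdsWithin hIcc).limsup_norm_slope_le hvq
      filter_upwards [hd', hsrc, self_mem_nhdsWithin] with t ht hts hst
      have hst' : 0 < t - s := sub_pos.2 hst
      rw [hin _ hts, hin _ hss]
      refine (hglip _ _).trans ?_
      rw [Real.norm_of_nonneg hst'.le, inv_mul_lt_iff₀ hst', mul_comm] at ht
      exact ht.le
  have hx0 : h x = r / 2 := by
    rw [hin x hxs]
    simp only [g, dist_self]
    rw [max_eq_left (by positivity)]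
    exact min_eq_right (by linarith)
  -- The sign `σ` treats curves leaving and curves entering at once: the slope bound concerns
  -- `|h|`-increments only.
  have habs : ∃ σ : ℝ, |σ| = 1 ∧ r / 2 ≤ σ * h y' - σ * h y := by
    rcases hy with ⟨rfl, hy'⟩ | ⟨rfl, hy'⟩
    · exact ⟨1, by simp, by rw [hout _ hy', hx0]; linarith⟩
    · exact ⟨-1, by simp, by rw [hout _ hy', hx0]; linarith⟩
  obtain ⟨σ, hσ, hσy⟩ := habs
  rw [finslerEDist]
  refine le_iInf₂ fun γ hγ ↦ le_iInf₂ fun h0 h1 ↦ ?_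
  rw [hF.finslerLength_eq hγ]
  refine ENNReal.ofReal_le_ofReal ?_
  have := sub_le_integral_of_eventually_le (D := fun s ↦ σ * h (γ s))
    (φ := fun s ↦ m⁻¹ * F (velocityWithin γ (Icc 0 1) s))
    (continuousOn_const.mul (hcont.comp_continuousOn hγ.continuousOn))
    (continuousOn_const.mul (hF.continuousOn_velocityWithin hγ)) fun s hs q hq ↦ by
      filter_upwards [hslope γ hγ s hs q hq] with t ht
      rw [← mul_sub]
      refine (le_abs_self _).trans ?_
      rwa [abs_mul, hσ, one_mul]
  rw [h0, h1, intervalIntegral.integral_const_mul] at this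
  have h3 := hσy.trans this
  rwa [le_inv_mul_iff₀ hm] at h3

/-- The distance to or from a point is bounded below outside a neighborhood of this point. -/
lemma IsFinsler.exists_le_finslerEDist [T2Space X] (hF : IsFinsler F) {x : X} {s : Set X}
    (hs : s ∈ 𝓝 x) : ∃ ε : ℝ, 0 < ε ∧ ∀ y ∉ s, ENNReal.ofReal ε ≤ finslerEDist F x y ∧
      ENNReal.ofReal ε ≤ finslerEDist F y x := by
  set φ := extChartAt (𝓡 n) x with hφ
  have hxs : x ∈ φ.source := mem_extChartAt_source x
  have htgt : φ.target ∈ 𝓝 (φ x) := (isOpen_extChartAt_target x).mem_nhds (φ.map_source hxs)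
  have hsymm : φ.symm ⁻¹' s ∈ 𝓝 (φ x) := by
    have := continuousAt_extChartAt_symm (I := 𝓡 n) x
    refine this ?_
    rwa [extChartAt_to_inv]
  obtain ⟨r, hr, hrs⟩ := Metric.nhds_basis_closedBall.mem_iff.1
    (Filter.inter_mem (Filter.inter_mem htgt hsymm)
      (eventually_nhdsWithin_iff.1 (hF.eventually_pos x)))
  -- The closed annulus is compact and avoids the centre, the only point of the ball where
  -- positivity may fail.
  set A := Metric.closedBall (φ x) r ∩ {z | r / 2 ≤ dist z (φ x)} with hA
  have hAc : IsCompact A := (isCompact_closedBall _ _).inter_right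
    (isClosed_le continuous_const (continuous_id.dist continuous_const))
  obtain ⟨m, hm, hmA⟩ := hF.exists_le_tangentChart (x₀ := x) hAc (fun z hz ↦ (hrs hz.1).1.1)
    (fun z hz ↦ (hrs hz.1).2 (by
      rintro rfl
      have : r / 2 ≤ dist (φ x) (φ x) := hz.2
      rw [dist_self] at this
      linarith))
  have hout : ∀ y ∉ s, y ∉ φ.symm '' Metric.closedBall (φ x) r := by
    rintro y hy ⟨z, hz, rfl⟩
    exact hy (hrs hz).1.2
  refine ⟨m * (r / 2), by positivity, fun y hy ↦ ⟨?_, ?_⟩⟩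
  · exact hF.le_finslerLength_of_annulus hr hm (fun z hz ↦ (hrs hz).1.1)
      (fun z hz hz' ↦ hmA z ⟨hz, hz'⟩) (Or.inl ⟨rfl, hout y hy⟩)
  · exact hF.le_finslerLength_of_annulus hr hm (fun z hz ↦ (hrs hz).1.1)
      (fun z hz hz' ↦ hmA z ⟨hz, hz'⟩) (Or.inr ⟨rfl, hout y hy⟩)

end Separation

end DiffPassivity

namespace DiffPassivity

/-! ### Differentiability of ODE solutions in the initial value -/

section Dependence

open scoped NNReal

/-- Differentiable dependence of the solutions of an ODE on the initial values, on a short time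
interval and for solutions which stay in a ball: the derivative solves the linearized equation. -/
theorem exists_hasDerivWithinAt_of_solutions {E : Type*} [NormedAddCommGroup E] [NormedSpace ℝ E]
    [CompleteSpace E] [ProperSpace E] {G : ℝ → E → E} {A : ℝ → E → E →L[ℝ] E} {z₀ : E} {ρ a b : ℝ}
    {L : ℝ≥0} (hab : a ≤ b) (hL0 : 0 < L) (hLb : L * (b - a) ≤ 1 / 2)
    (hG : ∀ t ∈ Icc a b, ∀ z ∈ Metric.closedBall z₀ ρ, HasFDerivAt (G t) (A t z) z)
    (hA : ContinuousOn (fun p : ℝ × E ↦ A p.1 p.2) (Icc a b ×ˢ Metric.closedBall z₀ ρ))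
    (hL : ∀ t ∈ Icc a b, ∀ z ∈ Metric.closedBall z₀ ρ, ‖A t z‖ ≤ L)
    {y : ℝ → ℝ → E} {S : Set ℝ} {s₀ : ℝ} (hs₀ : s₀ ∈ S)
    (hy : ∀ᶠ s in 𝓝[S] s₀, ∀ t ∈ Icc a b, y s t ∈ Metric.closedBall z₀ ρ ∧
      HasDerivWithinAt (y s) (G t (y s t)) (Icc a b) t)
    {v : E} (hv : HasDerivWithinAt (fun s ↦ y s a) v S s₀) :
    ∃ w : ℝ → E, w a = v ∧ ∀ t ∈ Icc a b,
      HasDerivWithinAt w (A t (y s₀ t) (w t)) (Icc a b) t ∧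
        HasDerivWithinAt (fun s ↦ y s t) (w t) S s₀ := by
  set B := Metric.closedBall z₀ ρ with hB
  have hBc : Convex ℝ B := convex_closedBall _ _
  have hy₀ := hy.self_of_nhdsWithin hs₀
  have hcy : ∀ s, (∀ t ∈ Icc a b, y s t ∈ B ∧ HasDerivWithinAt (y s) (G t (y s t)) (Icc a b) t) →
      ContinuousOn (y s) (Icc a b) := fun s hs t ht ↦ (hs t ht).2.continuousWithinAt
  have hIci : ∀ {f : ℝ → E} {f' : E} {t : ℝ}, t ∈ Ico a b →
      HasDerivWithinAt f f' (Icc a b) t → HasDerivWithinAt f f' (Ici t) t := by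
    intro f f' t ht h
    exact h.mono_of_mem_nhdsWithin (Icc_mem_nhdsGE_of_mem ht)
  -- the linearized equation
  have hAy : ContinuousOn (fun t ↦ A t (y s₀ t)) (Icc a b) :=
    hA.comp (continuousOn_id.prodMk (hcy s₀ hy₀)) fun t ht ↦ ⟨ht, (hy₀ t ht).1⟩
  -- On the ball of radius `‖v‖ + 1` around `v` the field is at most `L (2‖v‖ + 1)`; since `L (b -
  -- a) ≤ 1/2`, solutions cannot leave it.
  have hPL : IsPicardLindelof (fun t w ↦ A t (y s₀ t) w) (tmin := a) (tmax := b)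
      ⟨a, left_mem_Icc.2 hab⟩ v (‖v‖₊ + 1) 0 (L * (2 * ‖v‖₊ + 1)) L := by
    refine ⟨fun t ht ↦ ?_, fun w _ ↦ hAy.clm_apply continuousOn_const, fun t ht w hw ↦ ?_, ?_⟩
    · refine LipschitzWith.lipschitzOnWith ?_
      exact (A t (y s₀ t)).lipschitz.weaken (by exact_mod_cast hL t ht _ (hy₀ t ht).1)
    · have h1 : ‖w‖ ≤ 2 * ‖v‖ + 1 := by
        have h2 : dist w v ≤ ‖v‖ + 1 := by simpa using hw
        rw [dist_eq_norm] at h2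
        have := norm_le_norm_add_norm_sub' w v
        linarith
      calc ‖A t (y s₀ t) w‖ ≤ ‖A t (y s₀ t)‖ * ‖w‖ := (A t (y s₀ t)).le_opNorm w
        _ ≤ L * (2 * ‖v‖ + 1) := mul_le_mul (hL t ht _ (hy₀ t ht).1) h1 (norm_nonneg _) L.2
        _ = _ := by simp
    · simp only [sub_self, NNReal.coe_mul, NNReal.coe_add, NNReal.coe_ofNat, coe_nnnorm,
        NNReal.coe_one, NNReal.coe_zero, sub_zero]
      rw [max_eq_left (sub_nonneg.2 hab)]
      nlinarith [norm_nonneg v]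
  obtain ⟨w, hwa, hw⟩ := hPL.exists_eq_forall_mem_Icc_hasDerivWithinAt₀
  simp only at hwa
  have hwc : ContinuousOn w (Icc a b) := fun t ht ↦ (hw t ht).continuousWithinAt
  refine ⟨w, hwa, fun t ht ↦ ⟨hw t ht, ?_⟩⟩
  set C := ‖v‖ + 1 with hC
  have hC0 : 0 < C := by positivity
  set κ := Real.exp (L * (b - a)) with hκ
  have hκ1 : 1 ≤ κ := Real.one_le_exp (mul_nonneg L.2 (sub_nonneg.2 hab))
  -- Lipschitz dependence
  have hlip : ∀ᶠ s in 𝓝[S] s₀, ∀ t ∈ Icc a b, ‖y s t - y s₀ t‖ ≤ C * κ * |s - s₀| := by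
    have h1 : ∀ᶠ s in 𝓝[S] s₀, ‖y s a - y s₀ a‖ ≤ C * |s - s₀| := by
      have h2 := (hasDerivWithinAt_iff_isLittleO.1 hv).def one_pos
      filter_upwards [h2] with s hs
      have h3 := norm_le_norm_add_norm_sub' (y s a - y s₀ a) ((s - s₀) • v)
      rw [norm_smul, Real.norm_eq_abs] at h3
      rw [one_mul, Real.norm_eq_abs] at hs
      rw [hC, add_mul, one_mul, mul_comm ‖v‖]
      exact h3.trans (by gcongr)
    filter_upwards [hy, h1] with s hs hsa t ht
    have hlipG : ∀ t ∈ Ico a b, LipschitzOnWith L (G t) B := fun t ht ↦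
      hBc.lipschitzOnWith_of_nnnorm_hasFDerivWithin_le (f' := A t)
        (fun z hz ↦ (hG t ⟨ht.1, ht.2.le⟩ z hz).hasFDerivWithinAt)
        fun z hz ↦ hL t ⟨ht.1, ht.2.le⟩ z hz
    have h3 := dist_le_of_trajectories_ODE_of_mem (s := fun _ ↦ B) (δ := C * |s - s₀|) hlipG (hcy s hs)
      (fun t ht ↦ hIci ht (hs t ⟨ht.1, ht.2.le⟩).2) (fun t ht ↦ (hs t ⟨ht.1, ht.2.le⟩).1)
      (hcy s₀ hy₀) (fun t ht ↦ hIci ht (hy₀ t ⟨ht.1, ht.2.le⟩).2)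
      (fun t ht ↦ (hy₀ t ⟨ht.1, ht.2.le⟩).1) ((dist_eq_norm _ _).trans_le hsa) t ht
    rw [dist_eq_norm] at h3
    refine h3.trans ?_
    rw [mul_right_comm C κ]
    have : Real.exp (L * (t - a)) ≤ κ := by
      rw [hκ]; gcongr; exact ht.2
    exact mul_le_mul_of_nonneg_left this (mul_nonneg hC0.le (abs_nonneg _))
  rw [hasDerivWithinAt_iff_isLittleO, Asymptotics.isLittleO_iff]
  intro ε hε
  -- `δ D |s - s₀|` is the Grönwall bound for initial error `δ |s - s₀|` and forcing `δ C κ |s -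
  -- s₀|`, hence `δ = ε / D`.
  set D := κ + C * κ / L * (κ - 1) with hD
  have hD0 : 0 < D := by
    have : 0 ≤ C * κ / L * (κ - 1) := mul_nonneg (by positivity) (by linarith)
    have : 0 < κ := by linarith
    linarith
  set δ := ε / D with hδ
  have hδ0 : 0 < δ := by positivity
  have hinit : ∀ᶠ s in 𝓝[S] s₀, ‖y s a - y s₀ a - (s - s₀) • v‖ ≤ δ * |s - s₀| := by
    simpa using (hasDerivWithinAt_iff_isLittleO.1 hv).def hδ0
  have hunif := (isCompact_Icc.prod (isCompact_closedBall z₀ ρ)).uniformContinuousOn_of_continuous hA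
  obtain ⟨η, hη, hηA⟩ := Metric.uniformContinuousOn_iff_le.1 hunif δ hδ0
  have hsmall : ∀ᶠ s in 𝓝[S] s₀, C * κ * |s - s₀| ≤ η := by
    have : Filter.Tendsto (fun s ↦ C * κ * |s - s₀|) (𝓝[S] s₀) (𝓝 0) := by
      have h : ContinuousAt (fun s ↦ C * κ * |s - s₀|) s₀ := by fun_prop
      have h' := h.tendsto
      simp only [sub_self, abs_zero, mul_zero] at h'
      exact h'.mono_left nhdsWithin_le_nhds
    exact this (Iic_mem_nhds hη)
  filter_upwards [hy, hlip, hinit, hsmall] with s hs hls his hsη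
  -- The remainder of the first-order expansion solves the linearized equation up to the Taylor
  -- error of `G t`, which uniform continuity of `A` makes at most `δ ‖y s t - y s₀ t‖`.
  set R : ℝ → E := fun t ↦ y s t - y s₀ t - (s - s₀) • w t with hR
  have hRc : ContinuousOn R (Icc a b) :=
    ((hcy s hs).sub (hcy s₀ hy₀)).sub (continuousOn_const.smul hwc)
  have hRd : ∀ t ∈ Ico a b, HasDerivWithinAt R
      (G t (y s t) - G t (y s₀ t) - (s - s₀) • A t (y s₀ t) (w t)) (Ici t) t := by
    intro t ht
    have ht' : t ∈ Icc a b := ⟨ht.1, ht.2.le⟩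
    exact hIci ht (((hs t ht').2.sub (hy₀ t ht').2).sub ((hw t ht').const_smul _))
  have hbound : ∀ t ∈ Ico a b,
      ‖G t (y s t) - G t (y s₀ t) - (s - s₀) • A t (y s₀ t) (w t)‖ ≤
        L * ‖R t‖ + δ * (C * κ) * |s - s₀| := by
    intro t ht
    have ht' : t ∈ Icc a b := ⟨ht.1, ht.2.le⟩
    have h1 : ‖G t (y s t) - G t (y s₀ t) - A t (y s₀ t) (y s t - y s₀ t)‖ ≤
        δ * ‖y s t - y s₀ t‖ := by
      have hseg : segment ℝ (y s₀ t) (y s t) ⊆ B := hBc.segment_subset (hy₀ t ht').1 (hs t ht').1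
      refine (convex_segment (y s₀ t) (y s t)).norm_image_sub_le_of_norm_hasFDerivWithin_le'
        (f' := A t) (fun z hz ↦ (hG t ht' z (hseg hz)).hasFDerivWithinAt) (fun z hz ↦ ?_)
        (left_mem_segment _ _ _) (right_mem_segment _ _ _)
      rw [← dist_eq_norm]
      refine hηA (t, z) ⟨ht', hseg hz⟩ (t, y s₀ t) ⟨ht', (hy₀ t ht').1⟩ ?_
      rw [Prod.dist_eq, dist_self, max_eq_right dist_nonneg]
      refine le_trans ?_ (((hls t ht')).trans hsη)
      rw [← dist_eq_norm]
      have := segment_subset_closedBall_left (y s₀ t) (y s t) hz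
      rw [dist_comm (y s t)]
      exact this
    have h2 : G t (y s t) - G t (y s₀ t) - (s - s₀) • A t (y s₀ t) (w t) =
        A t (y s₀ t) (R t) + (G t (y s t) - G t (y s₀ t) - A t (y s₀ t) (y s t - y s₀ t)) := by
      simp only [hR, map_sub, map_smul]
      abel
    rw [h2]
    refine (norm_add_le _ _).trans (add_le_add ?_ ?_)
    · exact ((A t (y s₀ t)).le_opNorm _).trans
        (mul_le_mul_of_nonneg_right (hL t ht' _ (hy₀ t ht').1) (norm_nonneg _))
    · refine h1.trans ?_
      rw [mul_assoc]
      exact mul_le_mul_of_nonneg_left (hls t ht') hδ0.le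
  have hgr := norm_le_gronwallBound_of_norm_deriv_right_le hRc hRd
    (δ := δ * |s - s₀|) (by simpa [hR, hwa] using his) hbound t ht
  rw [Real.norm_eq_abs]
  refine hgr.trans ?_
  have hLne : (L : ℝ) ≠ 0 := by exact_mod_cast hL0.ne'
  rw [gronwallBound_of_K_ne_0 hLne]
  have hexp : Real.exp (L * (t - a)) ≤ κ := by
    rw [hκ]; gcongr; exact ht.2
  calc δ * |s - s₀| * Real.exp (L * (t - a)) +
        δ * (C * κ) * |s - s₀| / L * (Real.exp (L * (t - a)) - 1)
      ≤ δ * |s - s₀| * κ + δ * (C * κ) * |s - s₀| / L * (κ - 1) := by gcongr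
    _ = δ * D * |s - s₀| := by rw [hD]; ring
    _ = ε * |s - s₀| := by rw [hδ, div_mul_cancel₀ _ hD0.ne']

end Dependence

/-! ### Confinement of curves to a chart ball -/

section Confinement

variable {n : ℕ} {X : Type*} [TopologicalSpace X] [T2Space X]
  [ChartedSpace (EuclideanSpace ℝ (Fin n)) X]

/-- A curve whose speed is at most `M` on a ball of a chart stays in this ball for some time. -/
lemma mem_closedBall_of_speed_le {x₀ : X} {z₀ : EuclideanSpace ℝ (Fin n)} {ρ ρ₀ M a b : ℝ}
    (hρ : Metric.closedBall z₀ ρ ⊆ (extChartAt (𝓡 n) x₀).target) {x : ℝ → X}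
    {x' : ℝ → EuclideanSpace ℝ (Fin n)} (hxc : ContinuousOn x (Icc a b))
    (hx' : ∀ t ∈ Icc a b, x t ∈ (extChartAt (𝓡 n) x₀).source →
      HasDerivWithinAt (fun τ ↦ extChartAt (𝓡 n) x₀ (x τ)) (x' t) (Icc a b) t)
    (hM : ∀ t ∈ Icc a b, x t ∈ (extChartAt (𝓡 n) x₀).source →
      extChartAt (𝓡 n) x₀ (x t) ∈ Metric.closedBall z₀ ρ → ‖x' t‖ ≤ M) (hM0 : 0 ≤ M)
    (ha : x a ∈ (extChartAt (𝓡 n) x₀).source)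
    (ha' : extChartAt (𝓡 n) x₀ (x a) ∈ Metric.closedBall z₀ ρ₀) (hab : ρ₀ + M * (b - a) < ρ) :
    ∀ t ∈ Icc a b, x t ∈ (extChartAt (𝓡 n) x₀).source ∧
      extChartAt (𝓡 n) x₀ (x t) ∈ Metric.closedBall z₀ ρ := by
  rcases lt_or_ge b a with hba | hba
  · intro t ht
    rw [Icc_eq_empty (not_le.2 hba)] at ht
    exact ht.elim
  set φ := extChartAt (𝓡 n) x₀ with hφ
  set K := φ.symm '' Metric.closedBall z₀ ρ with hK
  have hKc : IsClosed K := ((isCompact_closedBall _ _).image_of_continuousOn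
    ((continuousOn_extChartAt_symm x₀).mono hρ)).isClosed
  have hKiff : ∀ p, p ∈ K ↔ p ∈ φ.source ∧ φ p ∈ Metric.closedBall z₀ ρ := by
    intro p
    constructor
    · rintro ⟨z, hz, rfl⟩
      exact ⟨φ.map_target (hρ hz), by rwa [φ.right_inv (hρ hz)]⟩
    · rintro ⟨h1, h2⟩
      exact ⟨φ p, h2, φ.left_inv h1⟩
  -- Continuous induction on the sharper bound `ρ₀ + M (t - a) < ρ`: the strict margin keeps the
  -- curve in the ball a little longer. Closedness of `s` rests on that of `K`, since chart
  -- coordinates mean nothing outside the chart domain.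
  set s := {t | x t ∈ K ∧ dist (φ (x t)) z₀ ≤ ρ₀ + M * (t - a)} with hs
  suffices h : Icc a b ⊆ s from fun t ht ↦ (hKiff _).1 (h ht).1
  refine IsClosed.Icc_subset_of_forall_exists_gt ?_ ?_ ?_
  · have h1 : IsClosed (Icc a b ∩ x ⁻¹' K) := hxc.preimage_isClosed_of_isClosed isClosed_Icc hKc
    have h2 : ContinuousOn (fun t ↦ dist (φ (x t)) z₀) (Icc a b ∩ x ⁻¹' K) := by
      intro t ht
      exact ((hx' t ht.1 ((hKiff _).1 ht.2).1).continuousWithinAt.mono inter_subset_left).dist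
        continuousWithinAt_const
    have h3 := h1.isClosed_le h2 (g := fun t ↦ ρ₀ + M * (t - a)) (by fun_prop)
    have h4 : s ∩ Icc a b =
        {t ∈ Icc a b ∩ x ⁻¹' K | dist (φ (x t)) z₀ ≤ ρ₀ + M * (t - a)} :=
      Subset.antisymm (fun t ht ↦ ⟨⟨ht.2, ht.1.1⟩, ht.1.2⟩) fun t ht ↦ ⟨⟨ht.1.2, ht.2⟩, ht.1.1⟩
    rw [h4]
    exact h3
  · refine ⟨(hKiff _).2 ⟨ha, Metric.closedBall_subset_closedBall ?_ ha'⟩, ?_⟩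
    · have := mul_nonneg hM0 (sub_nonneg.2 hba)
      linarith
    · simpa using ha'
  · rintro t ⟨⟨htK, htd⟩, ht⟩ y hy
    have ht' : t ∈ Icc a b := ⟨ht.1, ht.2.le⟩
    have hts := ((hKiff _).1 htK).1
    have hIcc : Icc a b ∈ 𝓝[>] t := Icc_mem_nhdsGT_of_mem ht
    have hlt : dist (φ (x t)) z₀ < ρ := by
      have : M * (t - a) ≤ M * (b - a) := by gcongr; exact ht'.2
      linarith
    have hev : ∀ᶠ τ in 𝓝[>] t, x τ ∈ φ.source ∧ φ (x τ) ∈ Metric.closedBall z₀ ρ := by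
      have h1 := ((hxc t ht').mono_of_mem_nhdsWithin hIcc)
        ((isOpen_extChartAt_source x₀).mem_nhds hts)
      have h2 := ((hx' t ht' hts).continuousWithinAt.mono_of_mem_nhdsWithin hIcc)
        (Metric.isOpen_ball.mem_nhds (Metric.mem_ball.2 hlt))
      filter_upwards [h1, h2] with τ hτ1 hτ2
      exact ⟨hτ1, Metric.ball_subset_closedBall hτ2⟩
    obtain ⟨u, hu, hut⟩ := (mem_nhdsGT_iff_exists_Ioc_subset).1 hev
    set t' := min u (min y b) with ht'def
    have htt' : t < t' := lt_min hu (lt_min hy ht.2)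
    have ht'b : t' ≤ b := (min_le_right _ _).trans (min_le_right _ _)
    have hsub : Icc t t' ⊆ Icc a b := Icc_subset_Icc ht.1 ht'b
    have hin : ∀ τ ∈ Icc t t', x τ ∈ φ.source ∧ φ (x τ) ∈ Metric.closedBall z₀ ρ := by
      intro τ hτ
      rcases hτ.1.eq_or_lt with rfl | hlt'
      · exact (hKiff _).1 htK
      · exact hut ⟨hlt', hτ.2.trans (min_le_left _ _)⟩
    have hmv := norm_image_sub_le_of_norm_deriv_le_segment' (f := fun τ ↦ φ (x τ)) (f' := x')
      (C := M) (fun τ hτ ↦ (hx' τ (hsub hτ) (hin τ hτ).1).mono hsub)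
      (fun τ hτ ↦ hM τ (hsub ⟨hτ.1, hτ.2.le⟩) (hin τ ⟨hτ.1, hτ.2.le⟩).1 (hin τ ⟨hτ.1, hτ.2.le⟩).2)
      t' ⟨htt'.le, le_rfl⟩
    refine ⟨t', ⟨(hKiff _).2 (hin t' ⟨htt'.le, le_rfl⟩), ?_⟩, htt',
      (min_le_right _ _).trans (min_le_left _ _)⟩
    rw [← dist_eq_norm] at hmv
    have := dist_triangle (φ (x t')) (φ (x t)) z₀
    linarith

end Confinement

end DiffPassivity

namespace DiffPassivity

/-! ### Families of solutions and the variational system -/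

namespace ControlSystem

open scoped NNReal

variable {n m : ℕ} {X : Type*} [TopologicalSpace X] [ChartedSpace (EuclideanSpace ℝ (Fin n)) X]
  [IsManifold (𝓡 n) ∞ X]

/-- The right-hand side of the system in the chart at `x₀`. -/
noncomputable def rhsCoord (S : ControlSystem n m X) (u : ℝ → EuclideanSpace ℝ (Fin m)) (x₀ : X)
    (t : ℝ) (z : EuclideanSpace ℝ (Fin n)) : EuclideanSpace ℝ (Fin n) :=
  fieldCoord x₀ S.f z + ∑ i, u t i • fieldCoord x₀ (S.g i) z

/-- The derivative, with respect to the state, of the right-hand side of the system in the chart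
at `x₀`. -/
noncomputable def linearizedRhs (S : ControlSystem n m X) (u : ℝ → EuclideanSpace ℝ (Fin m))
    (x₀ : X) (t : ℝ) (z : EuclideanSpace ℝ (Fin n)) :
    EuclideanSpace ℝ (Fin n) →L[ℝ] EuclideanSpace ℝ (Fin n) :=
  fderiv ℝ (fieldCoord x₀ S.f) z + ∑ i, u t i • fderiv ℝ (fieldCoord x₀ (S.g i)) z

variable {S : ControlSystem n m X} {u : ℝ → EuclideanSpace ℝ (Fin m)}

lemma hasFDerivAt_rhsCoord (S : ControlSystem n m X) (u : ℝ → EuclideanSpace ℝ (Fin m)) (x₀ : X)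
    (t : ℝ) {z : EuclideanSpace ℝ (Fin n)} (hz : z ∈ (extChartAt (𝓡 n) x₀).target) :
    HasFDerivAt (S.rhsCoord u x₀ t) (S.linearizedRhs u x₀ t z) z := by
  have hd : ∀ {w : VField n X}, IsCkFieldOn 2 w univ →
      HasFDerivAt (fieldCoord x₀ w) (fderiv ℝ (fieldCoord x₀ w) z) z := fun hw ↦
    (((contDiffOn_fieldCoord x₀ hw).contDiffAt
      ((isOpen_extChartAt_target x₀).mem_nhds hz)).differentiableAt (by simp)).hasFDerivAt
  exact (hd S.f_C2).add (HasFDerivAt.fun_sum fun i _ ↦ (hd (S.g_C2 i)).const_smul (u t i))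

lemma continuousOn_rhsCoord (hu : S.IsInput u) (x₀ : X) :
    ContinuousOn (fun p : ℝ × EuclideanSpace ℝ (Fin n) ↦ S.rhsCoord u x₀ p.1 p.2)
      (univ ×ˢ (extChartAt (𝓡 n) x₀).target) := by
  have hc : ∀ {w : VField n X}, IsCkFieldOn 2 w univ →
      ContinuousOn (fun p : ℝ × EuclideanSpace ℝ (Fin n) ↦ fieldCoord x₀ w p.2)
        (univ ×ˢ (extChartAt (𝓡 n) x₀).target) := fun hw ↦
    (contDiffOn_fieldCoord x₀ hw).continuousOn.comp continuousOn_snd fun p hp ↦ hp.2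
  have huc : ∀ i, Continuous (fun p : ℝ × EuclideanSpace ℝ (Fin n) ↦ u p.1 i) := fun i ↦ by
    have := hu.1.continuous
    fun_prop
  exact (hc S.f_C2).add (continuousOn_finsetSum _ fun i _ ↦
    (huc i).continuousOn.smul (hc (S.g_C2 i)))

lemma continuousOn_linearizedRhs (hu : S.IsInput u) (x₀ : X) :
    ContinuousOn (fun p : ℝ × EuclideanSpace ℝ (Fin n) ↦ S.linearizedRhs u x₀ p.1 p.2)
      (univ ×ˢ (extChartAt (𝓡 n) x₀).target) := by
  have hc : ∀ {w : VField n X}, IsCkFieldOn 2 w univ →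
      ContinuousOn (fun p : ℝ × EuclideanSpace ℝ (Fin n) ↦ fderiv ℝ (fieldCoord x₀ w) p.2)
        (univ ×ˢ (extChartAt (𝓡 n) x₀).target) := fun hw ↦
    ((contDiffOn_fieldCoord x₀ hw).continuousOn_fderiv_of_isOpen
      (isOpen_extChartAt_target x₀) (by norm_num)).comp continuousOn_snd fun p hp ↦ hp.2
  have huc : ∀ i, Continuous (fun p : ℝ × EuclideanSpace ℝ (Fin n) ↦ u p.1 i) := fun i ↦ by
    have := hu.1.continuous
    fun_prop
  exact (hc S.f_C2).add (continuousOn_finsetSum _ fun i _ ↦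
    (huc i).continuousOn.smul (hc (S.g_C2 i)))

lemma IsSolution.continuousOn {x : ℝ → X} (hx : S.IsSolution u x) : ContinuousOn x (Ici 0) :=
  fun t ht ↦ (hx t ht).continuousWithinAt

lemma IsSolution.hasDerivWithinAt_extChartAt {x : ℝ → X} (hx : S.IsSolution u x) {x₀ : X} {t : ℝ}
    (ht : 0 ≤ t) (hs : x t ∈ (extChartAt (𝓡 n) x₀).source) :
    HasDerivWithinAt (fun τ ↦ extChartAt (𝓡 n) x₀ (x τ))
      (S.rhsCoord u x₀ t (extChartAt (𝓡 n) x₀ (x t))) (Ici 0) t := by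
  have h := HasMFDerivWithinAt.hasDerivWithinAt_extChartAt (hx t ht) hs
  have h2 : vecCoord x₀ (S.f (x t) + ∑ i, u t i • S.g i (x t)) =
      S.rhsCoord u x₀ t (extChartAt (𝓡 n) x₀ (x t)) := by
    rw [vecCoord_add, vecCoord_sum, rhsCoord, fieldCoord_extChartAt hs]
    congr 1
    refine Finset.sum_congr rfl fun i _ ↦ ?_
    rw [vecCoord_smul, fieldCoord_extChartAt hs]
  rw [← h2]
  convert h using 1
  congr 1
  exact (one_smul ℝ _).symm

variable [T2Space X]

/-- Around each time, a family of solutions that is differentiable in the parameter at some time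
is so at the subsequent times, and its derivative solves the variational equation in a chart. -/
lemma exists_forall_mdifferentiableWithinAt (hu : S.IsInput u) {c : ℝ → ℝ → X}
    (hc : ∀ s, S.IsSolution u (c s)) {s₀ : ℝ} (hs₀ : s₀ ∈ Icc (0 : ℝ) 1) {t₀ : ℝ} (ht₀ : 0 ≤ t₀)
    {x₀ : X} (hx₀ : c s₀ t₀ ∈ (extChartAt (𝓡 n) x₀).source) :
    ∃ η > 0, ∀ a, 0 ≤ a → t₀ - η ≤ a →
      MDifferentiableWithinAt 𝓘(ℝ, ℝ) (𝓡 n) (fun s ↦ c s a) (Icc 0 1) s₀ →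
      ∀ t ∈ Icc a (t₀ + η),
        MDifferentiableWithinAt 𝓘(ℝ, ℝ) (𝓡 n) (fun s ↦ c s t) (Icc 0 1) s₀ ∧
        HasDerivWithinAt
          (fun τ ↦ vecCoord x₀
            (mfderivWithin 𝓘(ℝ, ℝ) (𝓡 n) (fun s ↦ c s τ) (Icc 0 1) s₀ (1 : ℝ)))
          (S.linearizedRhs u x₀ t (extChartAt (𝓡 n) x₀ (c s₀ t))
            (vecCoord x₀ (mfderivWithin 𝓘(ℝ, ℝ) (𝓡 n) (fun s ↦ c s t) (Icc 0 1) s₀ (1 : ℝ))))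
          (Icc a (t₀ + η)) t := by
  set φ := extChartAt (𝓡 n) x₀ with hφ
  set z₀ := φ (c s₀ t₀) with hz₀
  have hJ : UniqueDiffWithinAt ℝ (Icc (0 : ℝ) 1) s₀ := uniqueDiffOn_Icc zero_lt_one s₀ hs₀
  obtain ⟨ρ, hρ, hρt⟩ := Metric.nhds_basis_closedBall.mem_iff.1
    ((isOpen_extChartAt_target x₀).mem_nhds (φ.map_source hx₀))
  set Q := Icc (t₀ - 1) (t₀ + 1) ×ˢ Metric.closedBall z₀ ρ with hQ
  have hQc : IsCompact Q := isCompact_Icc.prod (isCompact_closedBall _ _)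
  have hQs : Q ⊆ univ ×ˢ φ.target := prod_mono (subset_univ _) hρt
  obtain ⟨M, hM⟩ := hQc.exists_bound_of_continuousOn ((S.continuousOn_rhsCoord hu x₀).mono hQs)
  obtain ⟨L', hL'⟩ :=
    hQc.exists_bound_of_continuousOn ((S.continuousOn_linearizedRhs hu x₀).mono hQs)
  set L : ℝ≥0 := L'.toNNReal + 1 with hL
  have hL'L : L' ≤ L := by
    rw [hL]; push_cast
    linarith [Real.le_coe_toNNReal L']
  have hL0 : 0 < L := by positivity
  have hLr : 0 < (L : ℝ) := by exact_mod_cast hL0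
  set N := max M 0 + 1 with hN
  have hN0 : 0 < N := by positivity
  have hMN : M ≤ N := (le_max_left M 0).trans (by linarith)
  have hev : ∀ᶠ t in 𝓝[Ici 0] t₀, c s₀ t ∈ φ.source ∧ φ (c s₀ t) ∈ Metric.ball z₀ (ρ / 2) := by
    have h1 := (hc s₀).continuousOn t₀ ht₀ ((isOpen_extChartAt_source x₀).mem_nhds hx₀)
    have h2 := ((hc s₀).hasDerivWithinAt_extChartAt ht₀ hx₀).continuousWithinAt
      (Metric.ball_mem_nhds _ (half_pos hρ))
    filter_upwards [h1, h2] with t h1 h2 using ⟨h1, h2⟩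
  obtain ⟨η₁, hη₁, hη₁t⟩ := Metric.mem_nhdsWithin_iff.1 hev
  -- `η₁ / 2` keeps the reference solution in the half ball, `1` keeps times in the compact set `Q`,
  -- `ρ / (8N)` limits displacement over time `2η` to `ρ / 4`, and `1 / (4L)` gives `L · 2η ≤ 1/2`.
  -- The choice precedes that of `a`.
  set η := min (η₁ / 2) (min 1 (min (ρ / (8 * N)) (1 / (4 * L)))) with hη
  have hη0 : 0 < η := by positivity
  have hηη₁ : η < η₁ := (min_le_left _ _).trans_lt (by linarith)
  have hη1 : η ≤ 1 := (min_le_right _ _).trans (min_le_left _ _)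
  have hηN : N * η ≤ ρ / 8 := by
    have : η ≤ ρ / (8 * N) :=
      (min_le_right _ _).trans ((min_le_right _ _).trans (min_le_left _ _))
    calc N * η ≤ N * (ρ / (8 * N)) := by gcongr
      _ = ρ / 8 := by field_simp
  have hηL : L * η ≤ 1 / 4 := by
    have : η ≤ 1 / (4 * L) :=
      (min_le_right _ _).trans ((min_le_right _ _).trans (min_le_right _ _))
    calc L * η ≤ L * (1 / (4 * L)) := by gcongr
      _ = 1 / 4 := by field_simp
  refine ⟨η, hη0, fun a ha0 hat hda t ht ↦ ?_⟩
  set b := t₀ + η with hb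
  have hab : a ≤ b := ht.1.trans ht.2
  have hba : b - a ≤ 2 * η := by linarith
  have hIQ : Icc a b ⊆ Icc (t₀ - 1) (t₀ + 1) := Icc_subset_Icc (by linarith) (by linarith)
  have hI0 : Icc a b ⊆ Ici 0 := fun τ hτ ↦ ha0.trans hτ.1
  have hnear : ∀ τ ∈ Icc a b, c s₀ τ ∈ φ.source ∧ φ (c s₀ τ) ∈ Metric.ball z₀ (ρ / 2) := by
    intro τ hτ
    refine hη₁t ⟨?_, hI0 hτ⟩
    rw [Metric.mem_ball, Real.dist_eq, abs_lt]
    have := hτ.1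
    have := hτ.2
    constructor <;> linarith
  have haa : a ∈ Icc a b := left_mem_Icc.2 hab
  have hsrc : ∀ᶠ s in 𝓝[Icc 0 1] s₀, c s a ∈ φ.source :=
    hda.continuousWithinAt ((isOpen_extChartAt_source x₀).mem_nhds (hnear a haa).1)
  have hdφ := HasMFDerivWithinAt.hasDerivWithinAt_extChartAt hda.hasMFDerivWithinAt (hnear a haa).1
  have hball : ∀ᶠ s in 𝓝[Icc 0 1] s₀, φ (c s a) ∈ Metric.ball z₀ (ρ / 2) :=
    hdφ.continuousWithinAt (Metric.isOpen_ball.mem_nhds (hnear a haa).2)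
  have hstay : ∀ᶠ s in 𝓝[Icc 0 1] s₀, ∀ τ ∈ Icc a b, c s τ ∈ φ.source ∧
      φ (c s τ) ∈ Metric.closedBall z₀ ρ := by
    filter_upwards [hsrc, hball] with s h1 h2
    refine mem_closedBall_of_speed_le (M := N) (ρ₀ := ρ / 2) hρt
      (x' := fun τ ↦ S.rhsCoord u x₀ τ (φ (c s τ))) ((hc s).continuousOn.mono hI0)
      (fun τ hτ hτs ↦ ((hc s).hasDerivWithinAt_extChartAt (hI0 hτ) hτs).mono hI0)
      (fun τ hτ _ hτb ↦ (hM (τ, φ (c s τ)) ⟨hIQ hτ, hτb⟩).trans hMN) hN0.le h1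
      (Metric.ball_subset_closedBall h2) ?_
    have : N * (b - a) ≤ N * (2 * η) := by gcongr
    linarith
  obtain ⟨w, hwa, hw⟩ := exists_hasDerivWithinAt_of_solutions (G := S.rhsCoord u x₀)
    (A := S.linearizedRhs u x₀) (z₀ := z₀) (ρ := ρ) (y := fun s τ ↦ φ (c s τ)) hab hL0
    (by
      have : (L : ℝ) * (b - a) ≤ L * (2 * η) := by gcongr
      linarith)
    (fun τ _ z hz ↦ S.hasFDerivAt_rhsCoord u x₀ τ (hρt hz))
    ((S.continuousOn_linearizedRhs hu x₀).mono (prod_mono (subset_univ _) hρt))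
    (fun τ hτ z hz ↦ (hL' (τ, z) ⟨hIQ hτ, hz⟩).trans hL'L) hs₀
    (by
      filter_upwards [hstay] with s hs τ hτ
      exact ⟨(hs τ hτ).2, ((hc s).hasDerivWithinAt_extChartAt (hI0 hτ) (hs τ hτ).1).mono hI0⟩)
    hdφ
  have hmd : ∀ τ ∈ Icc a b,
      MDifferentiableWithinAt 𝓘(ℝ, ℝ) (𝓡 n) (fun s ↦ c s τ) (Icc 0 1) s₀ := by
    intro τ hτ
    have hcφ := (hw τ hτ).2.continuousWithinAt
    -- Nearby curves remain in the chart domain, so continuity in `s` is recovered by inverting the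
    -- chart.
    have hc' : ContinuousWithinAt (fun s ↦ c s τ) (Icc 0 1) s₀ := by
      have h1 : ContinuousWithinAt (fun s ↦ φ.symm (φ (c s τ))) (Icc 0 1) s₀ :=
        ContinuousAt.comp_continuousWithinAt (g := φ.symm) (f := fun s ↦ φ (c s τ))
          (continuousAt_extChartAt_symm' (hnear τ hτ).1) hcφ
      refine h1.congr_of_eventuallyEq ?_ (φ.left_inv (hnear τ hτ).1).symm
      filter_upwards [hstay] with s hs
      exact (φ.left_inv (hs τ hτ).1).symm
    exact mdifferentiableWithinAt_of_extChartAt hc' (hnear τ hτ).1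
      (hw τ hτ).2.differentiableWithinAt
  have hweq : ∀ τ ∈ Icc a b, vecCoord x₀
      (mfderivWithin 𝓘(ℝ, ℝ) (𝓡 n) (fun s ↦ c s τ) (Icc 0 1) s₀ (1 : ℝ)) = w τ := by
    intro τ hτ
    exact hJ.eq_deriv _ (HasMFDerivWithinAt.hasDerivWithinAt_extChartAt
      (hmd τ hτ).hasMFDerivWithinAt (hnear τ hτ).1) (hw τ hτ).2
  refine ⟨hmd t ht, ?_⟩
  rw [hweq t ht]
  exact (hw t ht).1.congr_of_mem hweq ht

/-- Otherwise take the infimum `T` of the bad times. The local result around `T` has a width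
independent of the starting time, so it carries differentiability from a good time (`0`, or `T - η`)
past `T`. -/
lemma mdifferentiableWithinAt_of_solutions (hu : S.IsInput u) {c : ℝ → ℝ → X}
    (hc : ∀ s, S.IsSolution u (c s)) {s₀ : ℝ} (hs₀ : s₀ ∈ Icc (0 : ℝ) 1)
    (h0 : MDifferentiableWithinAt 𝓘(ℝ, ℝ) (𝓡 n) (fun s ↦ c s 0) (Icc 0 1) s₀) {t : ℝ}
    (ht : 0 ≤ t) : MDifferentiableWithinAt 𝓘(ℝ, ℝ) (𝓡 n) (fun s ↦ c s t) (Icc 0 1) s₀ := by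
  by_contra hnot
  set N := {τ : ℝ | 0 ≤ τ ∧
    ¬ MDifferentiableWithinAt 𝓘(ℝ, ℝ) (𝓡 n) (fun s ↦ c s τ) (Icc 0 1) s₀} with hN
  have hne : N.Nonempty := ⟨t, ht, hnot⟩
  have hbdd : BddBelow N := ⟨0, fun τ hτ ↦ hτ.1⟩
  set T := sInf N with hT
  have hT0 : 0 ≤ T := le_csInf hne fun τ hτ ↦ hτ.1
  obtain ⟨η, hη, h⟩ := exists_forall_mdifferentiableWithinAt hu hc hs₀ hT0
    (mem_extChartAt_source (I := 𝓡 n) (c s₀ T))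
  have ha : MDifferentiableWithinAt 𝓘(ℝ, ℝ) (𝓡 n) (fun s ↦ c s (max 0 (T - η))) (Icc 0 1) s₀ := by
    rcases le_total (T - η) 0 with h1 | h1
    · rwa [max_eq_left h1]
    · rw [max_eq_right h1]
      by_contra h2
      have := csInf_le hbdd (show T - η ∈ N from ⟨h1, h2⟩)
      linarith
  obtain ⟨τ, hτN, hτ⟩ := exists_lt_of_csInf_lt hne (show sInf N < T + η by linarith)
  refine hτN.2 (h _ (le_max_left _ _) (le_max_right _ _) ha τ ⟨?_, hτ.le⟩).1
  have : T ≤ τ := csInf_le hbdd hτN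
  exact max_le hτN.1 (by linarith)

/-- The derivative of a family of solutions with respect to its parameter is a solution of the
variational system. -/
lemma isVariationalSolution_of_solutions (hu : S.IsInput u) {c : ℝ → ℝ → X}
    (hc : ∀ s, S.IsSolution u (c s)) {s₀ : ℝ} (hs₀ : s₀ ∈ Icc (0 : ℝ) 1)
    (h0 : MDifferentiableWithinAt 𝓘(ℝ, ℝ) (𝓡 n) (fun s ↦ c s 0) (Icc 0 1) s₀) :
    S.IsVariationalSolution u (c s₀) (fun _ ↦ 0)
      (fun t ↦ mfderivWithin 𝓘(ℝ, ℝ) (𝓡 n) (fun s ↦ c s t) (Icc 0 1) s₀ (1 : ℝ)) := by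
  intro x₀ t ht hx₀
  obtain ⟨η, hη, h⟩ := exists_forall_mdifferentiableWithinAt hu hc hs₀ ht hx₀
  have h1 := (h (max 0 (t - η)) (le_max_left _ _) (le_max_right _ _)
    (mdifferentiableWithinAt_of_solutions hu hc hs₀ h0 (le_max_left _ _)) t
    ⟨max_le ht (by linarith), by linarith⟩).2
  have h2 : Icc (max 0 (t - η)) (t + η) ∈ 𝓝[Ici 0] t := by
    filter_upwards [self_mem_nhdsWithin, mem_nhdsWithin_of_mem_nhds
      (Icc_mem_nhds (show t - η < t by linarith) (show t < t + η by linarith))] with τ h3 h4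
    exact ⟨max_le h3 h4.1, h4.2⟩
  have key : ∀ z w : EuclideanSpace ℝ (Fin n), S.linearizedRhs u x₀ t z w =
      fderiv ℝ (fieldCoord x₀ S.f) z w + ∑ i, u t i • fderiv ℝ (fieldCoord x₀ (S.g i)) z w +
        ∑ i, (0 : EuclideanSpace ℝ (Fin m)) i • fieldCoord x₀ (S.g i) z := by
    intro z w
    simp [linearizedRhs]
  exact (h1.mono_of_mem_nhdsWithin h2).congr_deriv (key _ _)

/-- Along a family of solutions with the same input, the derivative with respect to the parameter
is bounded, in the sense of `F`, by its initial value. -/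
lemma exists_velocityWithin_le {V H : (x : X) → Submodule ℝ (TangentSpace (𝓡 n) x)}
    {F δS : TangentBundle (𝓡 n) X → ℝ} (hS : S.DifferentiallyPassiveWith V H F δS) :
    ∃ k : ℝ, 0 < k ∧ ∀ u, S.IsInput u → ∀ c : ℝ → ℝ → X, (∀ s, S.IsSolution u (c s)) →
      ∀ s₀ ∈ Icc (0 : ℝ) 1,
        MDifferentiableWithinAt 𝓘(ℝ, ℝ) (𝓡 n) (fun s ↦ c s 0) (Icc 0 1) s₀ → ∀ t, 0 ≤ t →
        F (velocityWithin (fun s ↦ c s t) (Icc 0 1) s₀) ≤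
          k * F (velocityWithin (fun s ↦ c s 0) (Icc 0 1) s₀) := by
  obtain ⟨hst, hpass⟩ := hS
  obtain ⟨c₁, c₂, p, hc₁, hc₂, hp, hb⟩ := hst.bounds
  have hp0 : 0 < p := by linarith
  -- The summand `1` keeps the constant positive when `c₂ = 0`.
  refine ⟨(c₂ / c₁) ^ p⁻¹ + 1, by positivity, fun u hu c hc s₀ hs₀ h0 t ht ↦ ?_⟩
  -- With `δu = 0` the right-hand side vanishes and `δS` is at most its initial value.
  have h1 := hpass u (c s₀) (fun _ ↦ 0) _ hu (hc s₀) contDiff_const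
    (isVariationalSolution_of_solutions hu hc hs₀ h0) t ht
  simp only [inner_zero_right, intervalIntegral.integral_zero, sub_nonpos] at h1
  have h2 := (hb (velocityWithin (fun s ↦ c s t) (Icc 0 1) s₀)).1
  have h3 := (hb (velocityWithin (fun s ↦ c s 0) (Icc 0 1) s₀)).2
  have h4 : c₁ * F (velocityWithin (fun s ↦ c s t) (Icc 0 1) s₀) ^ p ≤
      c₂ * F (velocityWithin (fun s ↦ c s 0) (Icc 0 1) s₀) ^ p := h2.trans (h1.trans h3)
  set A := F (velocityWithin (fun s ↦ c s t) (Icc 0 1) s₀)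
  set B := F (velocityWithin (fun s ↦ c s 0) (Icc 0 1) s₀)
  have hA : 0 ≤ A := hst.nonneg_F _
  have hB : 0 ≤ B := hst.nonneg_F _
  have h5 : A ^ p ≤ ((c₂ / c₁) ^ p⁻¹ * B) ^ p := by
    rw [Real.mul_rpow (by positivity) hB, Real.rpow_inv_rpow (by positivity) hp0.ne',
      div_mul_eq_mul_div, le_div_iff₀ hc₁, mul_comm]
    exact h4
  have h6 := (Real.rpow_le_rpow_iff hA (by positivity) hp0).1 h5
  linarith

end ControlSystem

end DiffPassivity

namespace DiffPassivity

/-! ### From extended distances to finite ones -/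

section ExtendedDistance

/-- An extended, not necessarily symmetric, distance which generates the topology. -/
structure IsTopologicalEDist {X : Type*} [TopologicalSpace X] (e : X → X → ℝ≥0∞) : Prop where
  self : ∀ x, e x x = 0
  triangle : ∀ x y z, e x z ≤ e x y + e y z
  tendsto_right : ∀ x, Filter.Tendsto (fun y ↦ e x y) (𝓝 x) (𝓝 0)
  tendsto_left : ∀ x, Filter.Tendsto (fun y ↦ e y x) (𝓝 x) (𝓝 0)
  separates : ∀ x, ∀ s ∈ 𝓝 x, ∃ ε : ℝ, 0 < ε ∧ ∀ y ∉ s,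
    ENNReal.ofReal ε ≤ e x y ∧ ENNReal.ofReal ε ≤ e y x

namespace IsTopologicalEDist

variable {X : Type*} [TopologicalSpace X] {e : X → X → ℝ≥0∞}

/-- Provides a finite distance with the same small-scale behaviour, both for disconnected manifolds
and while finiteness of the original is not known. -/
lemma truncate (he : IsTopologicalEDist e) {N : ℝ} (hN : 0 < N) :
    IsTopologicalEDist fun x y ↦ min (e x y) (ENNReal.ofReal N) := by
  refine ⟨fun x ↦ by simp [he.self], fun x y z ↦ ?_, fun x ↦ ?_, fun x ↦ ?_, fun x s hs ↦ ?_⟩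
  · rcases le_total (e x y) (ENNReal.ofReal N) with h1 | h1
    · rcases le_total (e y z) (ENNReal.ofReal N) with h2 | h2
      · rw [min_eq_left h1, min_eq_left h2]
        exact (min_le_left _ _).trans (he.triangle x y z)
      · rw [min_eq_right h2]
        exact (min_le_right _ _).trans le_add_self
    · rw [min_eq_right h1]
      exact (min_le_right _ _).trans le_self_add
  · exact tendsto_of_tendsto_of_tendsto_of_le_of_le tendsto_const_nhds (he.tendsto_right x)
      (fun _ ↦ zero_le) fun _ ↦ min_le_left _ _
  · exact tendsto_of_tendsto_of_tendsto_of_le_of_le tendsto_const_nhds (he.tendsto_left x)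
      (fun _ ↦ zero_le) fun _ ↦ min_le_left _ _
  · obtain ⟨ε, hε, h⟩ := he.separates x s hs
    refine ⟨min ε N, lt_min hε hN, fun y hy ↦ ⟨le_min ?_ ?_, le_min ?_ ?_⟩⟩
    · exact (ENNReal.ofReal_le_ofReal (min_le_left _ _)).trans (h y hy).1
    · exact ENNReal.ofReal_le_ofReal (min_le_right _ _)
    · exact (ENNReal.ofReal_le_ofReal (min_le_left _ _)).trans (h y hy).2
    · exact ENNReal.ofReal_le_ofReal (min_le_right _ _)

lemma toReal_triangle (he : IsTopologicalEDist e) (hfin : ∀ x y, e x y ≠ ⊤) (x y z : X) :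
    (e x z).toReal ≤ (e x y).toReal + (e y z).toReal := by
  rw [← ENNReal.toReal_add (hfin _ _) (hfin _ _)]
  exact ENNReal.toReal_mono (ENNReal.add_ne_top.2 ⟨hfin _ _, hfin _ _⟩) (he.triangle x y z)

lemma isDistance [T1Space X] (he : IsTopologicalEDist e) (hfin : ∀ x y, e x y ≠ ⊤) :
    IsDistance fun x y ↦ (e x y).toReal := by
  refine ⟨fun x y ↦ ENNReal.toReal_nonneg, fun x y ↦ ⟨fun h ↦ ?_, ?_⟩, he.toReal_triangle hfin⟩
  · by_contra hxy
    obtain ⟨ε, hε, h'⟩ := he.separates x {y}ᶜ (isOpen_compl_singleton.mem_nhds hxy)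
    have h1 := (h' y (by simp)).1
    rw [ENNReal.toReal_eq_zero_iff, or_iff_left (hfin x y)] at h
    rw [h, nonpos_iff_eq_zero, ENNReal.ofReal_eq_zero] at h1
    linarith
  · rintro rfl
    simp [he.self]

/-- Triangle inequalities through `x` and `y` squeeze the value at a nearby pair; without symmetry,
convergence of distances both to and from a point is needed. -/
lemma continuous_toReal (he : IsTopologicalEDist e) (hfin : ∀ x y, e x y ≠ ⊤) :
    Continuous fun p : X × X ↦ (e p.1 p.2).toReal := by
  have htri := he.toReal_triangle hfin
  have hr : ∀ x, Filter.Tendsto (fun y ↦ (e x y).toReal) (𝓝 x) (𝓝 0) := fun x ↦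
    (ENNReal.tendsto_toReal ENNReal.zero_ne_top).comp (he.tendsto_right x)
  have hl : ∀ x, Filter.Tendsto (fun y ↦ (e y x).toReal) (𝓝 x) (𝓝 0) := fun x ↦
    (ENNReal.tendsto_toReal ENNReal.zero_ne_top).comp (he.tendsto_left x)
  rw [continuous_iff_continuousAt]
  rintro ⟨x, y⟩
  have hf : Filter.Tendsto (fun p : X × X ↦ p.1) (𝓝 (x, y)) (𝓝 x) := continuous_fst.continuousAt
  have hs : Filter.Tendsto (fun p : X × X ↦ p.2) (𝓝 (x, y)) (𝓝 y) := continuous_snd.continuousAt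
  have h1 : Filter.Tendsto
      (fun p : X × X ↦ (e x y).toReal - ((e x p.1).toReal + (e p.2 y).toReal)) (𝓝 (x, y))
      (𝓝 (e x y).toReal) := by
    simpa using tendsto_const_nhds.sub (((hr x).comp hf).add ((hl y).comp hs))
  have h2 : Filter.Tendsto
      (fun p : X × X ↦ (e x y).toReal + ((e p.1 x).toReal + (e y p.2).toReal)) (𝓝 (x, y))
      (𝓝 (e x y).toReal) := by
    simpa using tendsto_const_nhds.add (((hl x).comp hf).add ((hr y).comp hs))
  refine tendsto_of_tendsto_of_tendsto_of_le_of_le h1 h2 (fun p ↦ ?_) fun p ↦ ?_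
  · have h3 := htri x p.1 y
    have h4 := htri p.1 p.2 y
    simp only
    linarith
  · have h3 := htri p.1 x p.2
    have h4 := htri x y p.2
    simp only
    linarith

lemma generatesTopology (he : IsTopologicalEDist e) (hfin : ∀ x y, e x y ≠ ⊤) :
    GeneratesTopology fun x y ↦ (e x y).toReal := by
  refine ⟨he.continuous_toReal hfin, fun x s hs ↦ ?_⟩
  obtain ⟨ε, hε, h⟩ := he.separates x s hs
  refine ⟨ε, hε, fun y hy ↦ ?_⟩
  by_contra hys
  have h1 := ENNReal.toReal_mono (hfin _ _) (h y hys).1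
  have h2 := ENNReal.toReal_mono (hfin _ _) (h y hys).2
  rw [ENNReal.toReal_ofReal hε.le] at h1 h2
  rcases hy with hy | hy <;> linarith

/-- The points at finite distance from `x` form a nonempty clopen set. -/
lemma ne_top [PreconnectedSpace X] (he : IsTopologicalEDist e) (x y : X) : e x y ≠ ⊤ := by
  have hclopen : IsClopen {z | e x z < ⊤} := by
    refine ⟨⟨isOpen_iff_mem_nhds.2 fun z hz ↦ ?_⟩, isOpen_iff_mem_nhds.2 fun z hz ↦ ?_⟩
    · filter_upwards [he.tendsto_left z (Iio_mem_nhds one_pos)] with w hw hxw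
      exact hz ((he.triangle x w z).trans_lt (ENNReal.add_lt_top.2
        ⟨hxw, (show e w z < 1 from hw).trans ENNReal.one_lt_top⟩))
    · filter_upwards [he.tendsto_right z (Iio_mem_nhds one_pos)] with w hw
      exact (he.triangle x z w).trans_lt (ENNReal.add_lt_top.2
        ⟨hz, (show e z w < 1 from hw).trans ENNReal.one_lt_top⟩)
  have huniv := hclopen.eq_univ ⟨x, by simp [he.self]⟩
  have : y ∈ {z | e x z < ⊤} := huniv ▸ mem_univ y
  exact this.ne

end IsTopologicalEDist

variable {n : ℕ} {X : Type*} [TopologicalSpace X] [T2Space X]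
  [ChartedSpace (EuclideanSpace ℝ (Fin n)) X] [IsManifold (𝓡 n) ∞ X]
  {F : TangentBundle (𝓡 n) X → ℝ}

lemma IsFinsler.isTopologicalEDist (hF : IsFinsler F) : IsTopologicalEDist (finslerEDist F) :=
  ⟨finslerEDist_self hF, finslerEDist_triangle hF, fun x ↦ (hF.tendsto_finslerEDist x).1,
    fun x ↦ (hF.tendsto_finslerEDist x).2, fun _ _ hs ↦ hF.exists_le_finslerEDist hs⟩

/-- If the velocities of a family of solutions are bounded by `k` times their initial values, then
so are the truncations of the distance of its endpoints. -/
lemma IsFinsler.min_finslerEDist_le (hF : IsFinsler F) {k : ℝ} (hk : 0 < k)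
    {γ c : ℝ → X} (hγ : ContMDiffOn 𝓘(ℝ, ℝ) (𝓡 n) 1 γ (Icc 0 1))
    (hc : ∀ s ∈ Icc (0 : ℝ) 1, MDifferentiableWithinAt 𝓘(ℝ, ℝ) (𝓡 n) c (Icc 0 1) s)
    (hle : ∀ s ∈ Icc (0 : ℝ) 1,
      F (velocityWithin c (Icc 0 1) s) ≤ k * F (velocityWithin γ (Icc 0 1) s))
    {N : ℝ} (hN : 0 < N) :
    min (finslerEDist F (c 0) (c 1)) (ENNReal.ofReal N) ≤ ENNReal.ofReal k * finslerLength F γ := by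
  obtain ⟨e, he, hdef⟩ : ∃ e : X → X → ℝ≥0∞, IsTopologicalEDist e ∧
      ∀ x y, e x y = min (finslerEDist F x y) (ENNReal.ofReal N) :=
    ⟨_, hF.isTopologicalEDist.truncate hN, fun _ _ ↦ rfl⟩
  have hfin : ∀ x y, e x y ≠ ⊤ := fun x y ↦
    ((hdef x y).trans_le (min_le_right _ _)).trans_lt ENNReal.ofReal_lt_top |>.ne
  rw [← hdef]
  have hcc : ContinuousOn c (Icc 0 1) := fun s hs ↦ (hc s hs).continuousWithinAt
  have hD : ContinuousOn (fun s ↦ (e (c 0) (c s)).toReal) (Icc 0 1) :=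
    (he.continuous_toReal hfin).comp_continuousOn (continuousOn_const.prodMk hcc)
  -- `c` is merely differentiable, so it is not itself a competitor for the infimum. The truncated
  -- distance from `c 0` is real and continuous along `c`, and its growth rate is at most `F(c') ≤ k
  -- F(γ')`, which is continuous.
  have h := sub_le_integral_of_eventually_le
    (φ := fun s ↦ k * F (velocityWithin γ (Icc 0 1) s)) hD
    (continuousOn_const.mul (hF.continuousOn_velocityWithin hγ)) ?_
  · simp only [he.self, ENNReal.toReal_zero, sub_zero, intervalIntegral.integral_const_mul] at h
    rw [hF.finslerLength_eq hγ, ← ENNReal.ofReal_mul hk.le]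
    exact (ENNReal.le_ofReal_iff_toReal_le (hfin _ _)
      (ENNReal.toReal_nonneg.trans h)).2 h
  · intro s hs r hr
    have hs' : s ∈ Icc (0 : ℝ) 1 := ⟨hs.1, hs.2.le⟩
    have hr0 : 0 ≤ r := (mul_nonneg hk.le (hF.nonneg _)).trans hr.le
    filter_upwards [hF.eventually_finslerEDist_le hs (hc s hs') ((hle s hs').trans_lt hr),
      self_mem_nhdsWithin] with t ht hst
    have h1 := he.toReal_triangle hfin (c 0) (c s) (c t)
    have h2 : (e (c s) (c t)).toReal ≤ r * (t - s) :=
      ENNReal.toReal_le_of_le_ofReal (mul_nonneg hr0 (sub_pos.2 hst).le)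
        ((hdef _ _).trans_le ((min_le_left _ _).trans ht))
    linarith

end ExtendedDistance

/-! ### Comparison of two solutions and conclusion -/

namespace ControlSystem

variable {n m : ℕ} {X : Type*} [TopologicalSpace X] [T2Space X]
  [ChartedSpace (EuclideanSpace ℝ (Fin n)) X] [IsManifold (𝓡 n) ∞ X] {S : ControlSystem n m X}

/-- The distance induced by `F` between two solutions with the same input is bounded by a multiple
of its initial value. -/
theorem exists_finslerEDist_le (hcomplete : S.ForwardComplete)
    {V H : (x : X) → Submodule ℝ (TangentSpace (𝓡 n) x)} {F δS : TangentBundle (𝓡 n) X → ℝ}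
    (hpassive : S.DifferentiallyPassiveWith V H F δS) (hV : ∀ x, V x = ⊥) :
    ∃ k : ℝ, 0 < k ∧ ∀ u, S.IsInput u → ∀ x₁ x₂ : ℝ → X, S.IsSolution u x₁ → S.IsSolution u x₂ →
      ∀ t, 0 ≤ t →
        finslerEDist F (x₁ t) (x₂ t) ≤ ENNReal.ofReal k * finslerEDist F (x₁ 0) (x₂ 0) := by
  classical
  have hF : IsFinsler F := hpassive.1.isFinsler hV
  obtain ⟨k, hk, hvel⟩ := exists_velocityWithin_le hpassive
  refine ⟨k, hk, fun u hu x₁ x₂ hx₁ hx₂ t ht ↦ ?_⟩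
  by_contra! hlt
  have hk0 : ENNReal.ofReal k ≠ 0 := (ENNReal.ofReal_pos.2 hk).ne'
  rw [mul_comm, ← ENNReal.lt_div_iff_mul_lt (Or.inl hk0) (Or.inl ENNReal.ofReal_ne_top)] at hlt
  obtain ⟨γ, hγ, h0, h1, hl⟩ := exists_finslerLength_lt hlt
  rw [ENNReal.lt_div_iff_mul_lt (Or.inl hk0) (Or.inl ENNReal.ofReal_ne_top), mul_comm] at hl
  choose z hz hz0 using fun s ↦ hcomplete u hu (γ s)
  -- Solutions are picked separately for each `s`, with the two given ones at the ends;
  -- differentiability in `s` comes from that of the initial curve.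
  let c : ℝ → ℝ → X := fun s ↦ if s = 0 then x₁ else if s = 1 then x₂ else z s
  have hc0 : c 0 = x₁ := if_pos rfl
  have hc1 : c 1 = x₂ := (if_neg one_ne_zero).trans (if_pos rfl)
  have hc : ∀ s, S.IsSolution u (c s) := by
    intro s
    simp only [c]
    split_ifs
    exacts [hx₁, hx₂, hz s]
  have hcγ : (fun s ↦ c s 0) = γ := by
    ext1 s
    simp only [c]
    split_ifs with hs hs'
    · rw [hs, h0]
    · rw [hs', h1]
    · exact hz0 s
  have hγd := hγ.mdifferentiableOn one_ne_zero
  have hbound : ∀ N : ℝ, 0 < N →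
      min (finslerEDist F (x₁ t) (x₂ t)) (ENNReal.ofReal N) ≤
        ENNReal.ofReal k * finslerLength F γ := by
    intro N hN
    have := hF.min_finslerEDist_le hk hγ (c := fun s ↦ c s t)
      (fun s hs ↦ mdifferentiableWithinAt_of_solutions hu hc hs (hcγ ▸ hγd s hs) ht)
      (fun s hs ↦ by
        have := hvel u hu c hc s hs (hcγ ▸ hγd s hs) t ht
        rwa [hcγ] at this) hN
    rwa [hc0, hc1] at this
  -- A level `N` above `k` times the length of `γ` contradicts the truncated bound, even if the
  -- distance at time `t` is infinite.
  have hltop : ENNReal.ofReal k * finslerLength F γ < ⊤ := hl.trans_le le_top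
  obtain ⟨N, -, hN, -⟩ := ENNReal.lt_iff_exists_real_btwn.1 hltop
  have hN0 : 0 < N := ENNReal.ofReal_pos.1 (lt_of_le_of_lt zero_le hN)
  exact absurd (hbound N hN0) (not_le.2 (lt_min hl hN))

lemma incrementallyStableWrt_toReal {e : X → X → ℝ≥0∞} (he : IsTopologicalEDist e)
    (hfin : ∀ x y, e x y ≠ ⊤) {k : ℝ} (hk : 0 < k)
    (h : ∀ u, S.IsInput u → ∀ x₁ x₂ : ℝ → X, S.IsSolution u x₁ → S.IsSolution u x₂ →
      ∀ t, 0 ≤ t → e (x₁ t) (x₂ t) ≤ ENNReal.ofReal k * e (x₁ 0) (x₂ 0)) :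
    S.IncrementallyStableWrt fun x y ↦ (e x y).toReal := by
  refine ⟨he.isDistance hfin, he.generatesTopology hfin, fun r ↦ k * r,
    ⟨by fun_prop, fun r _ r' _ hr ↦ by simpa using mul_lt_mul_of_pos_left hr hk, by simp⟩,
    fun u hu x₁ x₂ hx₁ hx₂ t ht ↦ ?_⟩
  have h1 := ENNReal.toReal_mono (ENNReal.mul_ne_top ENNReal.ofReal_ne_top (hfin _ _))
    (h u hu x₁ x₂ hx₁ hx₂ t ht)
  rwa [ENNReal.toReal_mul, ENNReal.toReal_ofReal hk.le] at h1

end ControlSystem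

end DiffPassivity

theorem theorem1 {n m : ℕ} {X : Type*} [TopologicalSpace X] [T2Space X]
    [SecondCountableTopology X] [ChartedSpace (EuclideanSpace ℝ (Fin n)) X]
    [IsManifold (𝓡 n) ∞ X]
    (S : DiffPassivity.ControlSystem n m X) (hcomplete : S.ForwardComplete)
    (V H : (x : X) → Submodule ℝ (TangentSpace (𝓡 n) x))
    (F δS : TangentBundle (𝓡 n) X → ℝ)
    (hpassive : S.DifferentiallyPassiveWith V H F δS)
    (hV : ∀ x, V x = ⊥) :
    S.IncrementallyStable ∧
      (ConnectedSpace X → S.IncrementallyStableWrt (DiffPassivity.finslerDist F)) := by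
  have hF : DiffPassivity.IsFinsler F := hpassive.1.isFinsler hV
  have he := hF.isTopologicalEDist
  obtain ⟨k, hk, hle⟩ :=
    DiffPassivity.ControlSystem.exists_finslerEDist_le hcomplete hpassive hV
  refine ⟨⟨_, DiffPassivity.ControlSystem.incrementallyStableWrt_toReal (he.truncate one_pos)
    (fun x y ↦ ((min_le_right _ _).trans_lt ENNReal.ofReal_lt_top).ne)
    (show 0 < max k 1 by positivity) fun u hu x₁ x₂ hx₁ hx₂ t ht ↦ ?_⟩, fun hconn ↦
    DiffPassivity.ControlSystem.incrementallyStableWrt_toReal he he.ne_top hk hle⟩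
  have h1 : (1 : ℝ≥0∞) ≤ ENNReal.ofReal (max k 1) := by
    rw [ENNReal.one_le_ofReal]
    exact le_max_right _ _
  -- The constant `max k 1` is at least `1`, so multiplication by it does not lower the cap of the
  -- truncated distance.
  rw [mul_min]
  refine min_le_min ((hle u hu x₁ x₂ hx₁ hx₂ t ht).trans ?_) (le_mul_of_one_le_left' h1)
  gcongr
  exact le_max_left _ _
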